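/- A cograph is a finite simple graph with no induced path on four vertices. Consider connected $n$-node graphs $G$ whose nodes $v$ carry pairwise distinct identifiers $\mathrm{id}(v)\in\{1,\dots,n^{k}\}$, where $k$ is a constant known to the nodes. A two-round distributed interactive proof with shared randomness ($\mathsf{dAM}$) works as follows. First, a uniformly random bit string $r$, shared by all nodes, is drawn and sent to a prover (Merlin), who knows $G$ and $\mathrm{id}$ and has unlimited computing power. Merlin answers with a certificate for each node. Then each node $v$ broadcasts one message to its neighbours, computed by a deterministic algorithm from $\mathrm{id}(v)$, $r$ and its certificate, and finally accepts or rejects by a deterministic algorithm based on $\mathrm{id}(v)$, $r$, its certificate and the messages received from its neighbours. Both algorithms are the same at every node and for all graphs; the nodes are given neither $G$ nor $n$. Theorem. Recognition of cographs is in $\mathsf{dAM}[\log n]$ with shared randomness, and the answer is correct with high probability. That is, for all constants $c$ and $k$ there is a protocol as above that uses $O(\log n)$ shared random bits, certificates of $O(\log n)$ bits and broadcast messages of $O(\log n)$ bits, such that, with $\varepsilon(n)=\min\{1/3,\,n^{-c}\}$, on every connected $n$-node graph $G$ with identifiers in $\{1,\dots,n^{k}\}$: - (completeness) if $G$ is a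 cograph, then Merlin can choose certificates of $O(\log n)$ bits so that all nodes accept with probability at least $1-\varepsilon(n)$; - (soundness) if $G$ is not a cograph, then, whatever certificates Merlin chooses (depending on $r$), at least one node rejects with probability at least $1-\varepsilon(n)$. Here $O(\log n)$ means at most $C(\lfloor\log_2 n\rfloor+1)$ for a constant $C$ that depends only on $c$ and $k$. -/

import Mathlib

/-- A network configuration `⟨G, id⟩` without input labels: a finite connected simple graph whose
nodes carry pairwise distinct positive integers as identifiers. -/
structure NetworkConfig where
  /-- the set of nodes -/
  V : Type
  [fintypeV : Fintype V]
  /-- the network -/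
  graph : SimpleGraph V
  connected : graph.Connected
  /-- the identifiers -/
  ident : V → ℕ
  ident_pos : ∀ v, 1 ≤ ident v
  ident_injective : Function.Injective ident

attribute [instance] NetworkConfig.fintypeV

namespace NetworkConfig

/-- The number `n` of nodes. -/
def size (N : NetworkConfig) : ℕ := Fintype.card N.V

end NetworkConfig

/-- A distributed language (without input labels) is a collection of network configurations. -/
abbrev DistributedLanguage := Set NetworkConfig

/-- The verifier (Arthur) of a two-round Arthur-Merlin protocol with shared randomness. It is the
same local algorithm at every node and for all network sizes: a node is given its own identifier,
the shared random string and its certificate, but neither the graph nor `n`.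

In the verification round a node first broadcasts one message to its neighbours, and then accepts
(`true`) or rejects (`false`). The messages from the neighbours arrive as a multiset: they carry no
information on the sender beyond their content. Both steps are deterministic algorithms. -/
structure Verifier where
  /-- the message broadcast by a node, from its identifier, the shared random string and its
  certificate -/
  message : ℕ → List Bool → List Bool → List Bool
  /-- the output of a node, from its identifier, the shared random string, its certificate and the
  messages received from its neighbours -/
  output : ℕ → List Bool → List Bool → Multiset (List Bool) → Bool
  message_computable :
    Computable fun x : ℕ × List Bool × List Bool => message x.1 x.2.1 x.2.2
  output_computable :
    Computable fun x : ℕ × List Bool × List Bool × List (List Bool) =>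
      output x.1 x.2.1 x.2.2.1 (x.2.2.2 : Multiset (List Bool))

/-- A prover (Merlin) on the configuration `N`, when the shared random string has `l` bits: he sees
the random string (and knows `N`), and gives a certificate to every node. -/
abbrev Prover (N : NetworkConfig) (l : ℕ) := (Fin l → Bool) → N.V → List Bool

namespace Verifier

open Classical in
/-- The node `v` accepts, when the shared random string is `r` and the certificates are `cert`. -/
def NodeAccepts (A : Verifier) (N : NetworkConfig) (r : List Bool) (cert : N.V → List Bool)
    (v : N.V) : Prop :=
  A.output (N.ident v) r (cert v)
    (((Finset.univ.filter fun w => N.graph.Adj v w).val).map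
      fun w => A.message (N.ident w) r (cert w)) = true

open Classical in
/-- The probability, over a uniformly random shared string of `l` bits, that every node accepts. -/
noncomputable def acceptProb (A : Verifier) (N : NetworkConfig) (l : ℕ) (M : Prover N l) : ℝ :=
  ((Finset.univ.filter fun r : Fin l → Bool =>
    ∀ v, A.NodeAccepts N (List.ofFn r) (M r) v).card : ℝ) / 2 ^ l

open Classical in
/-- The probability, over a uniformly random shared string of `l` bits, that at least one node
rejects. -/
noncomputable def rejectProb (A : Verifier) (N : NetworkConfig) (l : ℕ) (M : Prover N l) : ℝ :=
  ((Finset.univ.filter fun r : Fin l → Bool =>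
    ∃ v, ¬ A.NodeAccepts N (List.ofFn r) (M r) v).card : ℝ) / 2 ^ l

end Verifier

/-- `DAMPub ε f` is the class of distributed languages that have a distributed interactive proof
with two rounds (Arthur, then Merlin), shared randomness, bandwidth `O(f n)` and error probability
at most `ε n` on configurations with `n` nodes.

The identifiers are at most `n ^ k`, where the constant `k` is known to the nodes. The bandwidth
bounds the number of random bits sent to the prover, the length of the certificates of the honest
prover, and the length of the messages that the nodes exchange, whatever the certificates are.
Soundness holds against every prover, with certificates of any length. -/
def DAMPub (ε : ℕ → ℝ) (f : ℕ → ℕ) : Set DistributedLanguage :=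
  {L | ∀ k : ℕ, ∃ (A : Verifier) (C : ℕ),
    ∀ N : NetworkConfig, (∀ v, N.ident v ≤ N.size ^ k) →
      (∀ (r : Fin (C * f N.size) → Bool) (c : List Bool) (v : N.V),
        (A.message (N.ident v) (List.ofFn r) c).length ≤ C * f N.size) ∧
      (N ∈ L → ∃ M : Prover N (C * f N.size),
        (∀ r v, (M r v).length ≤ C * f N.size) ∧
          1 - ε N.size ≤ A.acceptProb N (C * f N.size) M) ∧
      (N ∉ L → ∀ M : Prover N (C * f N.size),
        1 - ε N.size ≤ A.rejectProb N (C * f N.size) M)}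

/-- A cograph is a graph without an induced path on four vertices. -/
def IsCograph {V : Type*} (G : SimpleGraph V) : Prop :=
  ¬ (SimpleGraph.pathGraph 4).IsIndContained G

/-- The language of all configurations whose graph is a cograph. -/
def cographLanguage : DistributedLanguage := {N | IsCograph N.graph}

/-! A `P₄`-free graph with at least two vertices is disconnected or has a disconnected complement
(`exists_isSplit`), so by induction it has two twins (`exists_twins`). Hence cographs are exactly
the graphs on which greedy merging of twin modules ends with a single class
(`isCograph_iff_merges`). Two merged modules are either completely joined or have no edge between
them, which creates no induced `P₄`. Conversely, representatives of the classes of a cograph induce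
a cograph, which has twins as long as two classes are left.

The merging only compares the sets `outer G A` and `outer G A ∪ A`. Each set `S` is replaced by the
polynomial `∑ v ∈ S, X ^ id v`, evaluated at a random point modulo a prime `p`. Fingerprints are
additive, so those of a merged class follow from those of its two parts, and the run starts from the
identifier and the neighbourhood fingerprint of every node. The sets compared in the run on sets do
not depend on the random point. There are `O(n²)` of them, and two distinct ones collide at no more
than `n ^ k` points. A prime of `O(log n)` bits therefore separates all of them with high
probability, and then the run on fingerprints mirrors the run on sets (`iterate_pairStep_map`).

It remains to collect the data of all nodes at one leader. A connected cograph is a join of `A` and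
`B`, say with `|B| ≤ |A|`. A leader in `B` sees all of `A`, and every `b ∈ B` gets its own partner
in `A`, adjacent to `b` and to the leader, whose certificate repeats the datum of `b`
(`exists_leader`). Local checks force every datum and every copy to be genuine and every node to be
visible to the leader, so Merlin cannot cheat unless the random point fails to separate
(`isCograph_of_nodeCheck`). -/

namespace Cograph

/-! ### Structure of `P₄`-free graphs: splits and twins -/

variable {V : Type*}

/-- No four vertices of `U` induce a path. -/
def P4FreeOn (G : SimpleGraph V) (U : Finset V) : Prop :=
  ∀ a ∈ U, ∀ b ∈ U, ∀ c ∈ U, ∀ d ∈ U,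
    ¬ (G.Adj a b ∧ G.Adj b c ∧ G.Adj c d ∧ ¬ G.Adj a c ∧ ¬ G.Adj a d ∧ ¬ G.Adj b d)

theorem P4FreeOn.mono {G : SimpleGraph V} {U W : Finset V} (h : P4FreeOn G W) (hUW : U ⊆ W) :
    P4FreeOn G U :=
  fun a ha b hb c hc d hd => h a (hUW ha) b (hUW hb) c (hUW hc) d (hUW hd)

/-- `P₄` is self-complementary: an induced path `a b c d` of the complement is the induced path `b d
a c` of the graph. -/
theorem P4FreeOn.compl {G : SimpleGraph V} {U : Finset V} (h : P4FreeOn G U) :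
    P4FreeOn Gᶜ U := by
  intro a ha b hb c hc d hd H
  have := h b hb d hd a ha c hc
  simp only [SimpleGraph.compl_adj] at H
  grind [SimpleGraph.adj_comm]

theorem isCograph_iff [Fintype V] (G : SimpleGraph V) :
    IsCograph G ↔ P4FreeOn G Finset.univ := by
  constructor
  · intro h a _ b _ c _ d _ ⟨hab, hbc, hcd, hac, had, hbd⟩
    -- The three edges and three non-edges already force the four vertices to be distinct.
    refine h ⟨⟨⟨![a, b, c, d], ?_⟩, ?_⟩⟩
    · intro i j hij
      fin_cases i <;> fin_cases j <;> simp at hij ⊢ <;> grind [SimpleGraph.adj_comm, G.irrefl]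
    · intro i j
      change G.Adj (![a, b, c, d] i) (![a, b, c, d] j) ↔ _
      have := G.irrefl (v := a)
      have := G.irrefl (v := b)
      have := G.irrefl (v := c)
      have := G.irrefl (v := d)
      fin_cases i <;> fin_cases j <;> simp [SimpleGraph.pathGraph_adj] <;>
        grind [SimpleGraph.adj_comm]
  · rintro h ⟨e⟩
    refine h (e 0) (Finset.mem_univ _) (e 1) (Finset.mem_univ _) (e 2) (Finset.mem_univ _) (e 3)
      (Finset.mem_univ _) ?_
    simp [e.map_rel_iff, SimpleGraph.pathGraph_adj]

/-- `U` is the disjoint union of the nonempty sets `A` and `B`, which are completely joined or have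
no edge between them. -/
structure IsSplit (G : SimpleGraph V) (U A B : Finset V) : Prop where
  left : A.Nonempty
  right : B.Nonempty
  disjoint : Disjoint A B
  mem_iff : ∀ x, x ∈ U ↔ x ∈ A ∨ x ∈ B
  uniform : (∀ a ∈ A, ∀ b ∈ B, ¬ G.Adj a b) ∨ ∀ a ∈ A, ∀ b ∈ B, G.Adj a b

theorem IsSplit.of_compl {G : SimpleGraph V} {U A B : Finset V} (h : IsSplit Gᶜ U A B) :
    IsSplit G U A B := by
  refine ⟨h.left, h.right, h.disjoint, h.mem_iff, ?_⟩
  have hne : ∀ a ∈ A, ∀ b ∈ B, a ≠ b := fun a ha b hb hab =>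
    Finset.disjoint_left.1 h.disjoint ha (hab ▸ hb)
  rcases h.uniform with h | h
  · exact .inr fun a ha b hb => by
      have := h a ha b hb
      simpa [SimpleGraph.compl_adj, hne a ha b hb] using this
  · exact .inl fun a ha b hb => (SimpleGraph.compl_adj _ _ _).1 (h a ha b hb) |>.2

open Classical in
-- Unless `v` is adjacent to all of `U`, take a non-neighbour `y` of `v` and its component `K` in
-- `U`. If `v` has no neighbour in `K`, or none in `U \ K`, that set splits off. Otherwise a walk in
-- `K` from `y` to a neighbour of `v` has an edge `s t` with only `t` adjacent to `v`, and for a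
-- neighbour `z` of `v` outside `K` the vertices `z v t s` induce a path.
theorem exists_isSplit_insert {G : SimpleGraph V} {U A B : Finset V} {v : V} (hv : v ∉ U)
    (hP : P4FreeOn G (insert v U)) (hA : A.Nonempty) (hB : B.Nonempty) (hAB : Disjoint A B)
    (hU : ∀ x, x ∈ U ↔ x ∈ A ∨ x ∈ B) (hanti : ∀ a ∈ A, ∀ b ∈ B, ¬ G.Adj a b) :
    ∃ A' B', IsSplit G (insert v U) A' B' := by
  by_cases hall : ∀ u ∈ U, G.Adj v u
  · refine ⟨{v}, U, by simp, ?_, by simpa using hv, by simp, .inr (by simpa using hall)⟩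
    obtain ⟨a, ha⟩ := hA
    exact ⟨a, (hU a).2 (.inl ha)⟩
  push Not at hall
  obtain ⟨y, hyU, hvy⟩ := hall
  wlog hyA : y ∈ A generalizing A B
  · exact this hB hA hAB.symm (fun x => (hU x).trans or_comm)
      (fun a ha b hb h => hanti b hb a ha h.symm) (((hU y).1 hyU).resolve_left hyA)
  let R : V → V → Prop := fun s t => G.Adj s t ∧ t ∈ U
  set K := U.filter (Relation.ReflTransGen R y) with hK
  have hKmem : ∀ {x}, x ∈ K ↔ x ∈ U ∧ Relation.ReflTransGen R y x := by simp [hK]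
  have hclosed : ∀ s ∈ K, ∀ t ∈ U, G.Adj s t → t ∈ K := fun s hs t ht hst =>
    hKmem.2 ⟨ht, (hKmem.1 hs).2.tail ⟨hst, ht⟩⟩
  have hyK : y ∈ K := hKmem.2 ⟨hyU, .refl⟩
  have hKA : K ⊆ A := by
    intro x hx
    have := (hKmem.1 hx).2
    induction this with
    | refl => exact hyA
    | @tail s t hs hst ih =>
      have hsU : s ∈ U := by
        rcases Relation.ReflTransGen.cases_tail hs with h | ⟨_, _, h⟩
        · exact h ▸ hyU
        · exact h.2
      have hsA := ih (hKmem.2 ⟨hsU, hs⟩)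
      refine ((hU t).1 hst.2).resolve_right fun htB => hanti s hsA t htB hst.1
  obtain ⟨b, hb⟩ := hB
  have hbK : b ∈ U \ K := Finset.mem_sdiff.2 ⟨(hU b).2 (.inr hb), fun h =>
    Finset.disjoint_left.1 hAB (hKA h) hb⟩
  have hKU : K ⊆ U := Finset.filter_subset _ _
  by_cases h1 : ∀ x ∈ K, ¬ G.Adj v x
  · refine ⟨K, insert v (U \ K), ⟨y, hyK⟩, by simp, ?_, ?_, .inl ?_⟩
    · rw [Finset.disjoint_left]; grind
    · grind
    · intro a ha b hb hadj
      rcases Finset.mem_insert.1 hb with rfl | hb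
      · exact h1 a ha hadj.symm
      · exact (Finset.mem_sdiff.1 hb).2 (hclosed a ha b (Finset.mem_sdiff.1 hb).1 hadj)
  by_cases h2 : ∀ x ∈ U \ K, ¬ G.Adj v x
  · refine ⟨insert v K, U \ K, by simp, ⟨b, hbK⟩, ?_, ?_, .inl ?_⟩
    · rw [Finset.disjoint_left]; grind
    · grind
    · intro a ha b hb hadj
      rcases Finset.mem_insert.1 ha with rfl | ha
      · exact h2 b hb hadj
      · exact (Finset.mem_sdiff.1 hb).2 (hclosed a ha b (Finset.mem_sdiff.1 hb).1 hadj)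
  push Not at h1 h2
  obtain ⟨x, hxK, hvx⟩ := h1
  obtain ⟨z, hz, hvz⟩ := h2
  have hst : ∃ s ∈ K, ∃ t ∈ K, G.Adj s t ∧ ¬ G.Adj v s ∧ G.Adj v t := by
    by_contra hno
    push Not at hno
    have key : ∀ u, Relation.ReflTransGen R y u → u ∈ K ∧ ¬ G.Adj v u := by
      intro u hu
      induction hu with
      | refl => exact ⟨hyK, hvy⟩
      | tail _ hst ih =>
        have := hclosed _ ih.1 _ hst.2 hst.1
        exact ⟨this, hno _ ih.1 _ this hst.1 ih.2⟩
    exact (key x (hKmem.1 hxK).2).2 hvx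
  obtain ⟨s, hs, t, ht, hadj, hvs, hvt⟩ := hst
  obtain ⟨hzU, hzK⟩ := Finset.mem_sdiff.1 hz
  have hzt : ¬ G.Adj z t := fun h => hzK (hclosed t ht z hzU h.symm)
  have hzs : ¬ G.Adj z s := fun h => hzK (hclosed s hs z hzU h.symm)
  exact (hP z (by simp [hzU]) v (by simp) t (by simp [hKU ht]) s (by simp [hKU hs])
    ⟨hvz.symm, hvt, hadj.symm, hzt, hzs, hvs⟩).elim

/-- Seinsche's theorem: a `P₄`-free graph with at least two vertices is disconnected, or its
complement is. -/
theorem exists_isSplit (G : SimpleGraph V) (U : Finset V) (hP : P4FreeOn G U) (hU : 2 ≤ U.card) :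
    ∃ A B, IsSplit G U A B := by
  classical
  induction U using Finset.induction_on with
  | empty => simp at hU
  | insert v U hv ih =>
    rcases Nat.lt_or_ge U.card 2 with h2 | h2
    · rw [Finset.card_insert_of_notMem hv] at hU
      obtain ⟨u, rfl⟩ := Finset.card_eq_one.1 (show U.card = 1 by omega)
      refine ⟨{v}, {u}, by simp, by simp, by simpa using hv, by simp, ?_⟩
      simpa using (em (G.Adj v u)).symm
    · obtain ⟨A, B, h⟩ := ih (hP.mono (Finset.subset_insert _ _)) h2
      rcases h.uniform with hu | hu
      · exact exists_isSplit_insert hv hP h.left h.right h.disjoint h.mem_iff hu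
      -- Completely joined parts have no edge between them in the complement, and `P₄`-freeness and
      -- splits are insensitive to complementation.
      · obtain ⟨A', B', h'⟩ := exists_isSplit_insert (G := Gᶜ) hv hP.compl h.left h.right h.disjoint
          h.mem_iff fun a ha b hb hab => ((SimpleGraph.compl_adj _ _ _).1 hab).2 (hu a ha b hb)
        exact ⟨A', B', h'.of_compl⟩

/-- A `P₄`-free graph with at least two vertices has two twins. -/
theorem exists_twins (G : SimpleGraph V) (U : Finset V) (hP : P4FreeOn G U) (hU : 2 ≤ U.card) :
    ∃ u ∈ U, ∃ v ∈ U, u ≠ v ∧ ∀ w ∈ U, w ≠ u → w ≠ v → (G.Adj u w ↔ G.Adj v w) := by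
  induction hn : U.card using Nat.strong_induction_on generalizing U with
  | _ n ih =>
    obtain ⟨A, B, h⟩ := exists_isSplit G U hP hU
    -- Twins within one part stay twins in `U`, since the other part does not distinguish vertices
    -- of this one. If both parts are singletons, their elements are twins vacuously.
    have aux : ∀ A B, IsSplit G U A B → 2 ≤ A.card →
        ∃ u ∈ U, ∃ v ∈ U, u ≠ v ∧ ∀ w ∈ U, w ≠ u → w ≠ v → (G.Adj u w ↔ G.Adj v w) := by
      intro A B h hA
      have hAU : A ⊆ U := fun x hx => (h.mem_iff x).2 (.inl hx)
      have hlt : A.card < U.card := by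
        refine Finset.card_lt_card (Finset.ssubset_iff_subset_ne.2 ⟨hAU, ?_⟩)
        rintro rfl
        obtain ⟨b, hb⟩ := h.right
        exact Finset.disjoint_left.1 h.disjoint ((h.mem_iff b).2 (.inr hb)) hb
      obtain ⟨u, hu, v, hv, huv, htw⟩ := ih A.card (hn ▸ hlt) A (hP.mono hAU) hA rfl
      refine ⟨u, hAU hu, v, hAU hv, huv, fun w hw hwu hwv => ?_⟩
      rcases (h.mem_iff w).1 hw with hw | hw
      · exact htw w hw hwu hwv
      · rcases h.uniform with hun | hun
        · exact iff_of_false (hun u hu w hw) (hun v hv w hw)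
        · exact iff_of_true (hun u hu w hw) (hun v hv w hw)
    rcases Nat.lt_or_ge A.card 2 with hA | hA
    · rcases Nat.lt_or_ge B.card 2 with hB | hB
      · have h1 := h.left.card_pos
        have h2 := h.right.card_pos
        obtain ⟨a, rfl⟩ := Finset.card_eq_one.1 (show A.card = 1 by omega)
        obtain ⟨b, rfl⟩ := Finset.card_eq_one.1 (show B.card = 1 by omega)
        refine ⟨a, (h.mem_iff a).2 (by simp), b, (h.mem_iff b).2 (by simp), ?_, fun w hw => ?_⟩
        · simpa using h.disjoint
        · rcases (h.mem_iff w).1 hw with hw | hw <;> simp at hw <;> simp [hw]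
      · refine aux B A ⟨h.right, h.left, h.disjoint.symm, fun x => (h.mem_iff x).trans or_comm, ?_⟩ hB
        rcases h.uniform with hun | hun
        · exact .inl fun a ha b hb hab => hun b hb a ha hab.symm
        · exact .inr fun a ha b hb => (hun b hb a ha).symm
    · exact aux A B h hA

open Classical in
-- A path is connected, so it stays on the side of its first vertex.
theorem P4FreeOn.union_of_anticomplete {G : SimpleGraph V} {A B : Finset V}
    (hA : P4FreeOn G A) (hB : P4FreeOn G B)
    (h : ∀ a ∈ A, ∀ b ∈ B, ¬ G.Adj a b) : P4FreeOn G (A ∪ B) := by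
  intro a ha b hb c hc d hd hP
  obtain ⟨hab, hbc, hcd, -⟩ := id hP
  rw [Finset.mem_union] at ha hb hc hd
  have h' : ∀ a ∈ A, ∀ b ∈ B, ¬ G.Adj b a := fun a ha b hb hab => h a ha b hb hab.symm
  rcases ha with ha | ha
  · have hb := hb.resolve_right fun hb => h a ha b hb hab
    have hc := hc.resolve_right fun hc => h b hb c hc hbc
    have hd := hd.resolve_right fun hd => h c hc d hd hcd
    exact hA a ha b hb c hc d hd hP
  · have hb := hb.resolve_left fun hb => h' b hb a ha hab
    have hc := hc.resolve_left fun hc => h' c hc b hb hbc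
    have hd := hd.resolve_left fun hd => h' d hd c hc hcd
    exact hB a ha b hb c hc d hd hP

theorem P4FreeOn.of_compl {G : SimpleGraph V} {U : Finset V} (h : P4FreeOn Gᶜ U) : P4FreeOn G U := by
  simpa using h.compl

open Classical in
theorem P4FreeOn.union_of_complete {G : SimpleGraph V} {A B : Finset V}
    (hA : P4FreeOn G A) (hB : P4FreeOn G B)
    (h : ∀ a ∈ A, ∀ b ∈ B, G.Adj a b) : P4FreeOn G (A ∪ B) :=
  (hA.compl.union_of_anticomplete hB.compl fun a ha b hb hab =>
    ((SimpleGraph.compl_adj _ _ _).1 hab).2 (h a ha b hb)).of_compl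

end Cograph

namespace Cograph

/-! ### Greedy merging in a list -/

section Merge

variable {α β : Type*}

open Classical in
/-- The ordered pairs of distinct elements of `L` that are related by `tw`. -/
noncomputable def twinPairs (tw : α → α → Prop) (L : List α) : List (α × α) :=
  L.flatMap fun a => L.flatMap fun b => if a ≠ b ∧ tw a b then [(a, b)] else []

open Classical in
/-- Replace the first pair of elements of `L` related by `tw` by the value of `mg` at it. -/
noncomputable def mergeStep (tw : α → α → Prop) (mg : α → α → α) (L : List α) : List α :=
  (twinPairs tw L).head?.elim L fun q =>
    mg q.1 q.2 :: L.flatMap fun e => if e ≠ q.1 ∧ e ≠ q.2 then [e] else []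

theorem mem_twinPairs {tw : α → α → Prop} {L : List α} {q : α × α} :
    q ∈ twinPairs tw L ↔ q.1 ∈ L ∧ q.2 ∈ L ∧ q.1 ≠ q.2 ∧ tw q.1 q.2 := by
  classical
  simp only [twinPairs, List.mem_flatMap]
  constructor
  · rintro ⟨a, ha, b, hb, h⟩
    split_ifs at h with hab
    · simp only [List.mem_singleton] at h
      subst h
      exact ⟨ha, hb, hab⟩
    · simp at h
  · rintro ⟨ha, hb, hab⟩
    exact ⟨q.1, ha, q.2, hb, by simp [hab]⟩

/-- Selections are defined through `flatMap`, the shape treated by `primrec_flatMap_ite`; as filters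
they are easier to count. -/
theorem flatMap_ite_singleton (p : α → Prop) [DecidablePred p] (L : List α) :
    (L.flatMap fun e => if p e then [e] else []) = L.filter (fun e => decide (p e)) := by
  induction L with
  | nil => rfl
  | cons a L ih =>
    rw [List.flatMap_cons, ih]
    by_cases h : p a <;> simp [h]

theorem mergeStep_cases (tw : α → α → Prop) (mg : α → α → α) (L : List α) :
    (mergeStep tw mg L = L ∧ ∀ a ∈ L, ∀ b ∈ L, a ≠ b → ¬ tw a b) ∨
      ∃ a ∈ L, ∃ b ∈ L, a ≠ b ∧ tw a b ∧ (mergeStep tw mg L).length < L.length ∧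
        ∀ e, e ∈ mergeStep tw mg L ↔ e = mg a b ∨ e ∈ L ∧ e ≠ a ∧ e ≠ b := by
  classical
  cases h : (twinPairs tw L).head? with
  | none =>
    refine .inl ⟨by simp [mergeStep, h], fun a ha b hb hab htw => ?_⟩
    rw [List.head?_eq_none_iff] at h
    have : (a, b) ∈ twinPairs tw L := mem_twinPairs.2 ⟨ha, hb, hab, htw⟩
    simp [h] at this
  | some q =>
    obtain ⟨ha, hb, hab, htw⟩ := mem_twinPairs.1 (List.mem_of_head? h)
    have heq : mergeStep tw mg L =
        mg q.1 q.2 :: L.filter (fun e => decide (e ≠ q.1 ∧ e ≠ q.2)) := by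
      simp only [mergeStep, h, Option.elim_some]
      rw [← flatMap_ite_singleton]
    refine .inr ⟨q.1, ha, q.2, hb, hab, htw, ?_, fun e => by simp [heq]⟩
    -- Each of the two filters loses at least one entry, even if `L` has repetitions, and only one
    -- entry is added.
    have h1 : (L.filter fun e => decide (e ≠ q.1)).length < L.length :=
      List.length_filter_lt_length_iff_exists.2 ⟨q.1, ha, by simp⟩
    have h2 : ((L.filter fun e => decide (e ≠ q.1)).filter fun e => decide (e ≠ q.2)).length <
        (L.filter fun e => decide (e ≠ q.1)).length :=
      List.length_filter_lt_length_iff_exists.2 ⟨q.2, by simpa [hb] using hab.symm, by simp⟩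
    rw [List.filter_filter] at h2
    have h3 : L.filter (fun e => decide (e ≠ q.1 ∧ e ≠ q.2)) =
        L.filter fun e => decide (e ≠ q.2) && decide (e ≠ q.1) := by
      congr 1; ext e; simp [Bool.and_comm]
    rw [heq, List.length_cons, h3]
    omega

theorem length_mergeStep_le (tw : α → α → Prop) (mg : α → α → α) (L : List α) :
    (mergeStep tw mg L).length ≤ L.length := by
  rcases mergeStep_cases tw mg L with h | ⟨_, _, _, _, _, _, h, _⟩
  · rw [h.1]
  · exact h.le

theorem length_iterate_mergeStep_le (tw : α → α → Prop) (mg : α → α → α) (L : List α) (n : ℕ) :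
    ((mergeStep tw mg)^[n] L).length ≤ L.length := by
  induction n with
  | zero => rfl
  | succ n ih =>
    rw [Function.iterate_succ_apply']
    exact (length_mergeStep_le tw mg _).trans ih

/-- After as many steps as there are elements, no twins are left. -/
theorem iterate_mergeStep_no_twins (tw : α → α → Prop) (mg : α → α → α) (n : ℕ) (L : List α)
    (hn : L.length ≤ n) (a : α) (ha : a ∈ (mergeStep tw mg)^[n] L) (b : α)
    (hb : b ∈ (mergeStep tw mg)^[n] L) (hab : a ≠ b) : ¬ tw a b := by
  induction n generalizing L with
  | zero =>
    rw [List.length_eq_zero_iff.1 (Nat.le_zero.1 hn)] at ha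
    simp at ha
  | succ n ih =>
    rcases mergeStep_cases tw mg L with h | ⟨_, _, _, _, _, _, h, _⟩
    · rw [Function.iterate_fixed h.1] at ha hb
      exact h.2 a ha b hb hab
    · rw [Function.iterate_succ_apply] at ha hb
      exact ih _ (by omega) ha hb

theorem iterate_mergeStep_induction {tw : α → α → Prop} {mg : α → α → α} {P : List α → Prop}
    (hP : ∀ L, P L → P (mergeStep tw mg L)) {L : List α} (hL : P L) (n : ℕ) :
    P ((mergeStep tw mg)^[n] L) := by
  induction n with
  | zero => exact hL
  | succ n ih =>
    rw [Function.iterate_succ_apply']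
    exact hP _ ih

/-- The pair to be merged is chosen by its position in the list, so the choice commutes with `F`.
This transfers a run on sets to a run on fingerprints; `mg'` has to be correct on twins only. -/
theorem mergeStep_map {tw : α → α → Prop} {mg : α → α → α} {tw' : β → β → Prop}
    {mg' : β → β → β} {F : α → β} {L : List α}
    (hinj : ∀ a ∈ L, ∀ b ∈ L, F a = F b → a = b)
    (htw : ∀ a ∈ L, ∀ b ∈ L, a ≠ b → (tw' (F a) (F b) ↔ tw a b))
    (hmg : ∀ a ∈ L, ∀ b ∈ L, a ≠ b → tw a b → mg' (F a) (F b) = F (mg a b)) :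
    mergeStep tw' mg' (L.map F) = (mergeStep tw mg L).map F := by
  classical
  have hpairs : twinPairs tw' (L.map F) = (twinPairs tw L).map (Prod.map F F) := by
    simp only [twinPairs, List.map_flatMap, List.flatMap_map]
    refine List.flatMap_congr fun a ha => List.flatMap_congr fun b hb => ?_
    by_cases hab : a = b
    · simp [hab]
    · have : F a ≠ F b := fun h => hab (hinj a ha b hb h)
      simp only [ne_eq, this, not_false_eq_true, htw a ha b hb hab, true_and, hab]
      split_ifs <;> simp
  simp only [mergeStep, hpairs, List.head?_map]
  cases h : (twinPairs tw L).head? with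
  | none => simp
  | some q =>
    obtain ⟨ha, hb, hab, hq⟩ := mem_twinPairs.1 (List.mem_of_head? h)
    simp only [Option.map_some, Option.elim_some, Prod.map_fst, Prod.map_snd, List.map_cons,
      hmg _ ha _ hb hab hq, List.map_flatMap, List.flatMap_map]
    congr 1
    refine List.flatMap_congr fun e he => ?_
    have h1 : F e = F q.1 ↔ e = q.1 := ⟨hinj _ he _ ha, fun h => h ▸ rfl⟩
    have h2 : F e = F q.2 ↔ e = q.2 := ⟨hinj _ he _ hb, fun h => h ▸ rfl⟩
    simp only [ne_eq, h1, h2]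
    split_ifs <;> simp

end Merge

/-! ### Merging twin modules -/

section Modules

variable {V : Type*} [Fintype V] {G : SimpleGraph V} {A B : Finset V} {L : List (Finset V)}

open Classical in
/-- The neighbours of `A` outside `A`. -/
noncomputable def outer (G : SimpleGraph V) (A : Finset V) : Finset V :=
  Finset.univ.filter fun w => w ∉ A ∧ ∃ a ∈ A, G.Adj a w

theorem mem_outer {w : V} : w ∈ outer G A ↔ w ∉ A ∧ ∃ a ∈ A, G.Adj a w := by
  simp [outer]

open Classical in
/-- `A` and `B` have the same neighbours outside, up to the edges between them. -/
def SetTwins (G : SimpleGraph V) (A B : Finset V) : Prop :=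
  outer G A = outer G B ∨ outer G A ∪ A = outer G B ∪ B

open Classical in
/-- Merge the first pair of twins. -/
noncomputable def setStep (G : SimpleGraph V) : List (Finset V) → List (Finset V) :=
  mergeStep (SetTwins G) (· ∪ ·)

open Classical in
theorem outer_union_of_eq (h : outer G A = outer G B) :
    outer G (A ∪ B) = outer G A := by
  ext w
  have h' := Finset.ext_iff.1 h w
  simp only [mem_outer, Finset.mem_union] at h' ⊢
  grind

open Classical in
-- By disjointness, each set must lie in the outer neighbourhood of the other. The inclusion `B ⊆
-- outer G A` is what allows the fingerprint of the difference to be computed by subtraction.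
theorem outer_union_of_closed_eq (hd : Disjoint A B)
    (h : outer G A ∪ A = outer G B ∪ B) :
    B ⊆ outer G A ∧ A ⊆ outer G B ∧ outer G (A ∪ B) = outer G A \ B := by
  rw [Finset.disjoint_left] at hd
  have h' := Finset.ext_iff.1 h
  simp only [Finset.mem_union] at h'
  refine ⟨fun w hw => ?_, fun w hw => ?_, ?_⟩
  · grind
  · grind
  · ext w
    have h' := h' w
    simp only [mem_outer, Finset.mem_union, Finset.mem_sdiff] at h' ⊢
    grind

/-- The members of `L` are nonempty `P₄`-free modules that partition the vertices. -/
structure IsModulePartition (G : SimpleGraph V) (L : List (Finset V)) : Prop where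
  nonempty : ∀ A ∈ L, A.Nonempty
  disjoint : ∀ A ∈ L, ∀ B ∈ L, A ≠ B → Disjoint A B
  cover : ∀ v, ∃ A ∈ L, v ∈ A
  adj : ∀ A ∈ L, ∀ a ∈ A, ∀ w ∈ outer G A, G.Adj a w
  p4Free : ∀ A ∈ L, P4FreeOn G A

/-- Equal outer neighbourhoods exclude edges between the two modules, and equal closed ones force
all of them. In both cases the union is again a `P₄`-free module. -/
theorem IsModulePartition.setStep (h : IsModulePartition G L) :
    IsModulePartition G (setStep G L) := by
  classical
  rcases mergeStep_cases (SetTwins G) (· ∪ ·) L with h0 | ⟨A, hA, B, hB, hAB, htw, -, hmem⟩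
  · rw [Cograph.setStep, h0.1]
    exact h
  have hd := h.disjoint A hA B hB hAB
  have hnew : (∀ a ∈ A ∪ B, ∀ w ∈ outer G (A ∪ B), G.Adj a w) ∧ P4FreeOn G (A ∪ B) := by
    rcases htw with htw | htw
    · refine ⟨fun a ha w hw => ?_, (h.p4Free A hA).union_of_anticomplete (h.p4Free B hB) ?_⟩
      · rw [outer_union_of_eq htw] at hw
        rcases Finset.mem_union.1 ha with ha | ha
        · exact h.adj A hA a ha w hw
        · exact h.adj B hB a ha w (htw ▸ hw)
      · intro a ha b hb hab
        have hbA : b ∈ outer G A := mem_outer.2 ⟨fun h' => Finset.disjoint_left.1 hd h' hb, a, ha, hab⟩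
        rw [htw] at hbA
        exact (mem_outer.1 hbA).1 hb
    · obtain ⟨hBA, hAB', ho⟩ := outer_union_of_closed_eq hd htw
      refine ⟨fun a ha w hw => ?_, (h.p4Free A hA).union_of_complete (h.p4Free B hB) ?_⟩
      · rw [ho, Finset.mem_sdiff] at hw
        rcases Finset.mem_union.1 ha with ha | ha
        · exact h.adj A hA a ha w hw.1
        · have : w ∈ outer G B ∪ B := htw ▸ Finset.mem_union_left _ hw.1
          exact h.adj B hB a ha w ((Finset.mem_union.1 this).resolve_right hw.2)
      · exact fun a ha b hb => h.adj A hA a ha b (hBA hb)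
  have hsplit : ∀ C ∈ Cograph.setStep G L, C = A ∪ B ∨ C ∈ L ∧ C ≠ A ∧ C ≠ B :=
    fun C hC => (hmem C).1 hC
  have hdis : ∀ C ∈ L, C ≠ A → C ≠ B → Disjoint (A ∪ B) C := fun C hC h1 h2 =>
    Finset.disjoint_union_left.2 ⟨h.disjoint A hA C hC h1.symm, h.disjoint B hB C hC h2.symm⟩
  refine ⟨fun C hC => ?_, fun C hC D hD hCD => ?_, fun v => ?_, fun C hC => ?_, fun C hC => ?_⟩
  · rcases hsplit C hC with rfl | hC
    · exact (h.nonempty A hA).mono Finset.subset_union_left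
    · exact h.nonempty C hC.1
  · rcases hsplit C hC with rfl | hC <;> rcases hsplit D hD with rfl | hD
    · exact (hCD rfl).elim
    · exact hdis D hD.1 hD.2.1 hD.2.2
    · exact (hdis C hC.1 hC.2.1 hC.2.2).symm
    · exact h.disjoint C hC.1 D hD.1 hCD
  · obtain ⟨C, hC, hv⟩ := h.cover v
    by_cases hCAB : C = A ∨ C = B
    · refine ⟨A ∪ B, (hmem _).2 (.inl rfl), Finset.mem_union.2 ?_⟩
      rcases hCAB with rfl | rfl
      · exact .inl hv
      · exact .inr hv
    · push Not at hCAB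
      exact ⟨C, (hmem _).2 (.inr ⟨hC, hCAB⟩), hv⟩
  · rcases hsplit C hC with rfl | hC
    · exact hnew.1
    · exact h.adj C hC.1
  · rcases hsplit C hC with rfl | hC
    · exact hnew.2
    · exact h.p4Free C hC.1

theorem isModulePartition_singletons (h1 : ∀ A ∈ L, ∃ v, A = {v}) (h2 : ∀ v, {v} ∈ L) :
    IsModulePartition G L := by
  refine ⟨fun A hA => ?_, fun A hA B hB hAB => ?_, fun v => ⟨{v}, h2 v, by simp⟩,
    fun A hA a ha w hw => ?_, fun A hA => ?_⟩
  · obtain ⟨v, rfl⟩ := h1 A hA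
    simp
  · obtain ⟨v, rfl⟩ := h1 A hA
    obtain ⟨w, rfl⟩ := h1 B hB
    simpa [eq_comm] using hAB
  · obtain ⟨v, rfl⟩ := h1 A hA
    rw [mem_outer] at hw
    simp_all
  · obtain ⟨v, rfl⟩ := h1 A hA
    intro a ha b hb c hc d hd hP
    rw [Finset.mem_singleton] at ha hb
    subst ha hb
    exact G.irrefl hP.1

/-- In a `P₄`-free graph, a partition into at least two modules has two twins. -/
theorem IsModulePartition.exists_setTwins (h : IsModulePartition G L)
    (hP : P4FreeOn G Finset.univ) {A B : Finset V} (hA : A ∈ L) (hB : B ∈ L) (hAB : A ≠ B) :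
    ∃ C ∈ L, ∃ D ∈ L, C ≠ D ∧ SetTwins G C D := by
  classical
  -- A representative of every set in `L`; outside `L` the value is arbitrary.
  have hrep : ∀ C : Finset V, ∃ r, C ∈ L → r ∈ C := fun C => by
    by_cases hC : C ∈ L
    · obtain ⟨r, hr⟩ := h.nonempty C hC
      exact ⟨r, fun _ => hr⟩
    · obtain ⟨r, -⟩ := h.nonempty A hA
      exact ⟨r, fun h => (hC h).elim⟩
  choose rep hrep using hrep
  have hne : ∀ C ∈ L, ∀ D ∈ L, C ≠ D → ∀ c ∈ C, c ∉ D := fun C hC D hD hCD c hc hc' =>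
    Finset.disjoint_left.1 (h.disjoint C hC D hD hCD) hc hc'
  let U : Finset V := (L.map rep).toFinset
  have hU : ∀ u, u ∈ U ↔ ∃ C ∈ L, rep C = u := by simp [U]
  have hcard : 2 ≤ U.card := by
    refine Finset.one_lt_card.2 ⟨rep A, (hU _).2 ⟨A, hA, rfl⟩, rep B, (hU _).2 ⟨B, hB, rfl⟩, ?_⟩
    exact fun heq => hne A hA B hB hAB _ (hrep A hA) (heq ▸ hrep B hB)
  obtain ⟨u, hu, v, hv, huv, htw⟩ := exists_twins G U (hP.mono (Finset.subset_univ _)) hcard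
  obtain ⟨C, hC, rfl⟩ := (hU u).1 hu
  obtain ⟨D, hD, rfl⟩ := (hU v).1 hv
  have hCD : C ≠ D := fun h => huv (h ▸ rfl)
  -- An outer neighbour of `C` in a third module `E` is passed on to `D` through the representative
  -- of `E`, as adjacency between distinct modules is decided by representatives.
  have key : ∀ C ∈ L, ∀ D ∈ L, C ≠ D →
      (∀ w ∈ U, w ≠ rep C → w ≠ rep D → (G.Adj (rep C) w ↔ G.Adj (rep D) w)) →
      ∀ w ∈ outer G C, w ∉ D → w ∈ outer G D := by
    intro C hC D hD hCD htw w hw hwD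
    obtain ⟨E, hE, hwE⟩ := h.cover w
    have hEC : E ≠ C := fun h => (mem_outer.1 hw).1 (h ▸ hwE)
    have hED : E ≠ D := fun h => hwD (h ▸ hwE)
    have h1 : G.Adj (rep C) w := h.adj C hC _ (hrep C hC) w hw
    have h2 : rep C ∈ outer G E :=
      mem_outer.2 ⟨hne C hC E hE hEC.symm _ (hrep C hC), w, hwE, h1.symm⟩
    have h3 : G.Adj (rep E) (rep C) := h.adj E hE _ (hrep E hE) _ h2
    have h4 : G.Adj (rep D) (rep E) := by
      refine (htw _ ((hU _).2 ⟨E, hE, rfl⟩) ?_ ?_).1 h3.symm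
      · exact fun heq => hne E hE C hC hEC _ (hrep E hE) (heq ▸ hrep C hC)
      · exact fun heq => hne E hE D hD hED _ (hrep E hE) (heq ▸ hrep D hD)
    have h5 : rep D ∈ outer G E :=
      mem_outer.2 ⟨hne D hD E hE hED.symm _ (hrep D hD), _, hrep E hE, h4.symm⟩
    exact mem_outer.2 ⟨hwD, _, hrep D hD, (h.adj E hE w hwE _ h5).symm⟩
  have htw' : ∀ w ∈ U, w ≠ rep D → w ≠ rep C → (G.Adj (rep D) w ↔ G.Adj (rep C) w) :=
    fun w hw h1 h2 => (htw w hw h2 h1).symm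
  refine ⟨C, hC, D, hD, hCD, ?_⟩
  -- Adjacent representatives mean completely joined modules, whose closed neighbourhoods agree;
  -- otherwise there is no edge between the modules and the open ones agree.
  by_cases hadj : G.Adj (rep C) (rep D)
  · have full : ∀ C ∈ L, ∀ D ∈ L, C ≠ D → G.Adj (rep C) (rep D) → C ⊆ outer G D := by
      intro C hC D hD hCD hadj w hw
      have h1 : rep D ∈ outer G C :=
        mem_outer.2 ⟨hne D hD C hC hCD.symm _ (hrep D hD), _, hrep C hC, hadj⟩
      exact mem_outer.2 ⟨hne C hC D hD hCD w hw, _, hrep D hD, (h.adj C hC w hw _ h1).symm⟩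
    have f1 := full C hC D hD hCD hadj
    have f2 := full D hD C hC hCD.symm hadj.symm
    refine .inr (Finset.Subset.antisymm (fun w hw => ?_) (fun w hw => ?_))
    · by_cases hwD : w ∈ D
      · exact Finset.mem_union_right _ hwD
      · rcases Finset.mem_union.1 hw with hw | hw
        · exact Finset.mem_union_left _ (key C hC D hD hCD htw w hw hwD)
        · exact Finset.mem_union_left _ (f1 hw)
    · by_cases hwC : w ∈ C
      · exact Finset.mem_union_right _ hwC
      · rcases Finset.mem_union.1 hw with hw | hw
        · exact Finset.mem_union_left _ (key D hD C hC hCD.symm htw' w hw hwC)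
        · exact Finset.mem_union_left _ (f2 hw)
  · have anti : ∀ C ∈ L, ∀ D ∈ L, C ≠ D → ¬ G.Adj (rep C) (rep D) → ∀ w ∈ outer G C, w ∉ D := by
      intro C hC D hD hCD hadj w hw hwD
      have h1 : G.Adj (rep C) w := h.adj C hC _ (hrep C hC) w hw
      have h2 : rep C ∈ outer G D :=
        mem_outer.2 ⟨hne C hC D hD hCD _ (hrep C hC), w, hwD, h1.symm⟩
      exact hadj (h.adj D hD _ (hrep D hD) _ h2).symm
    refine .inl (Finset.Subset.antisymm (fun w hw => ?_) (fun w hw => ?_))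
    · exact key C hC D hD hCD htw w hw (anti C hC D hD hCD hadj w hw)
    · exact key D hD C hC hCD.symm htw' w hw
        (anti D hD C hC hCD.symm (fun h => hadj h.symm) w hw)

theorem IsModulePartition.iterate (h : IsModulePartition G L) (n : ℕ) :
    IsModulePartition G ((Cograph.setStep G)^[n] L) :=
  iterate_mergeStep_induction (fun _ h => h.setStep) h n

/-- Merging twins greedily ends with a single module exactly on cographs. -/
theorem isCograph_iff_merges (h : IsModulePartition G L) [Nonempty V] :
    IsCograph G ↔ ∀ A ∈ (setStep G)^[L.length] L, ∀ B ∈ (setStep G)^[L.length] L, A = B := by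
  classical
  rw [isCograph_iff]
  have hn := h.iterate L.length
  constructor
  · intro hP A hA B hB
    by_contra hAB
    obtain ⟨C, hC, D, hD, hCD, htw⟩ := hn.exists_setTwins hP hA hB hAB
    exact iterate_mergeStep_no_twins _ _ _ L le_rfl C hC D hD hCD htw
  · intro hall
    obtain ⟨v⟩ := ‹Nonempty V›
    obtain ⟨A, hA, -⟩ := hn.cover v
    refine (hn.p4Free A hA).mono fun w _ => ?_
    obtain ⟨B, hB, hw⟩ := hn.cover w
    exact hall B hB A hA ▸ hw

end Modules

end Cograph

/-! ### Fingerprints and the simulation of merging -/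

namespace Cograph

variable {V : Type*}

/-- The fingerprint of the set `S`: the polynomial `∑ v ∈ S, X ^ id v`, evaluated at `x` modulo
`p`. -/
def fingerprint (p x : ℕ) (id : V → ℕ) (S : Finset V) : ℕ := (∑ v ∈ S, x ^ id v) % p

theorem fingerprint_lt {p x : ℕ} {id : V → ℕ} {S : Finset V} (hp : 0 < p) :
    fingerprint p x id S < p := Nat.mod_lt _ hp

open Classical in
theorem fingerprint_union {p x : ℕ} {id : V → ℕ} {S T : Finset V} (h : Disjoint S T) :
    fingerprint p x id (S ∪ T) = (fingerprint p x id S + fingerprint p x id T) % p := by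
  rw [fingerprint, Finset.sum_union h, Nat.add_mod]
  rfl

open Classical in
-- The factor `p - 1` plays the role of `-1` modulo `p`, so that the arithmetic stays in `ℕ`.
theorem fingerprint_sdiff {p x : ℕ} {id : V → ℕ} {S T : Finset V} (hp : 0 < p) (h : T ⊆ S) :
    fingerprint p x id (S \ T) =
      (fingerprint p x id S + (p - 1) * fingerprint p x id T) % p := by
  have h1 : fingerprint p x id S = (fingerprint p x id (S \ T) + fingerprint p x id T) % p := by
    rw [← fingerprint_union Finset.sdiff_disjoint, Finset.sdiff_union_of_subset h]
  obtain ⟨q, rfl⟩ := Nat.exists_eq_succ_of_ne_zero hp.ne'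
  have h2 : fingerprint (q + 1) x id (S \ T) = fingerprint (q + 1) x id (S \ T) % (q + 1) :=
    (Nat.mod_eq_of_lt (fingerprint_lt hp)).symm
  have h3 : fingerprint (q + 1) x id (S \ T) + fingerprint (q + 1) x id T +
      q * fingerprint (q + 1) x id T =
      fingerprint (q + 1) x id (S \ T) + (q + 1) * fingerprint (q + 1) x id T := by ring
  simp only [Nat.succ_eq_add_one, Nat.add_sub_cancel] at h1 h2 ⊢
  rw [h1, Nat.mod_add_mod, h3, Nat.add_mul_mod_self_left, ← h2]

/-- Few evaluation points do not separate two given sets. -/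
theorem card_fingerprint_eq_le {p D : ℕ} [Fact p.Prime] {id : V → ℕ}
    (hid : Function.Injective id) (hD : ∀ v, id v ≤ D) {S T : Finset V} (hST : S ≠ T) :
    ((Finset.range p).filter fun x => fingerprint p x id S = fingerprint p x id T).card ≤ D := by
  classical
  let P : Finset V → Polynomial (ZMod p) := fun S => ∑ v ∈ S, Polynomial.X ^ id v
  have hcoeff : ∀ S : Finset V, ∀ v, (P S).coeff (id v) = if v ∈ S then 1 else 0 := by
    intro S v
    simp only [P, Polynomial.finsetSum_coeff, Polynomial.coeff_X_pow, hid.eq_iff]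
    simp
  -- As identifiers are distinct, the coefficients of `P S` at identifiers are the indicator
  -- function of `S`. Collision points are then roots of a nonzero polynomial of degree at most `D`.
  have hne : P S - P T ≠ 0 := by
    intro h
    refine hST (Finset.ext fun v => ?_)
    have := congrArg (fun q => q.coeff (id v)) (sub_eq_zero.1 h)
    simp only [hcoeff] at this
    by_cases h1 : v ∈ S <;> by_cases h2 : v ∈ T <;> simp_all
  have hdegP : ∀ S : Finset V, (P S).natDegree ≤ D := fun S =>
    Polynomial.natDegree_sum_le_of_forall_le _ _ fun v _ =>
      (Polynomial.natDegree_X_pow_le _).trans (hD v)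
  have hdeg : (P S - P T).natDegree ≤ D :=
    (Polynomial.natDegree_sub_le _ _).trans (max_le (hdegP S) (hdegP T))
  have heval : ∀ (S : Finset V) (x : ℕ),
      (P S).eval (x : ZMod p) = ((fingerprint p x id S : ℕ) : ZMod p) := by
    intro S x
    simp [P, fingerprint, Polynomial.eval_finsetSum]
  refine le_trans ?_ ((Polynomial.card_roots' (P S - P T)).trans hdeg)
  refine le_trans ?_ (Multiset.toFinset_card_le _)
  refine Finset.card_le_card_of_injOn (fun x : ℕ => (x : ZMod p)) ?_ ?_
  · intro x hx
    simp only [Finset.coe_filter, Set.mem_ofPred_eq] at hx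
    simp only [Finset.mem_coe, Multiset.mem_toFinset]
    rw [Polynomial.mem_roots hne, Polynomial.IsRoot, Polynomial.eval_sub, heval, heval, hx.2,
      sub_self]
  · intro x hx y hy hxy
    simp only [Finset.coe_filter, Set.mem_ofPred_eq, Finset.mem_range] at hx hy
    have := (ZMod.natCast_eq_natCast_iff' _ _ _).1 hxy
    rwa [Nat.mod_eq_of_lt hx.1, Nat.mod_eq_of_lt hy.1] at this

open Classical in
theorem card_not_injOn_fingerprint_le {p D : ℕ} [Fact p.Prime] {id : V → ℕ}
    (hid : Function.Injective id) (hD : ∀ v, id v ≤ D) (F : Finset (Finset V)) :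
    ((Finset.range p).filter fun x =>
      ¬ Set.InjOn (fingerprint p x id) (F : Set (Finset V))).card ≤ F.card ^ 2 * D := by
  have hsub : ((Finset.range p).filter fun x =>
      ¬ Set.InjOn (fingerprint p x id) (F : Set (Finset V))) ⊆
      F.offDiag.biUnion fun q => (Finset.range p).filter fun x =>
        fingerprint p x id q.1 = fingerprint p x id q.2 := by
    intro x hx
    simp only [Finset.mem_filter, Set.InjOn, Finset.mem_coe] at hx
    obtain ⟨hxp, hx⟩ := hx
    push Not at hx
    obtain ⟨S, hS, T, hT, h, hne⟩ := hx
    simp only [Finset.mem_biUnion, Finset.mem_offDiag, Finset.mem_filter]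
    exact ⟨(S, T), ⟨hS, hT, hne⟩, hxp, h⟩
  refine (Finset.card_le_card hsub).trans ?_
  refine (Finset.card_biUnion_le_card_mul _ _ D fun q hq => ?_).trans ?_
  · exact card_fingerprint_eq_le hid hD (Finset.mem_offDiag.1 hq).2.2
  · rw [Finset.offDiag_card, pow_two]
    exact Nat.mul_le_mul_right _ (Nat.sub_le _ _)

/-- The twin test on fingerprints of a set and of its outer neighbourhood. -/
def PairTwins (p : ℕ) (s t : ℕ × ℕ) : Prop := s.2 = t.2 ∨ (s.2 + s.1) % p = (t.2 + t.1) % p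

/-- The fingerprints of the union of two twins. -/
def pairMerge (p : ℕ) (s t : ℕ × ℕ) : ℕ × ℕ :=
  ((s.1 + t.1) % p, if s.2 = t.2 then s.2 else (s.2 + (p - 1) * t.1) % p)

/-- Merge the first pair of apparent twins. -/
noncomputable def pairStep (p : ℕ) : List (ℕ × ℕ) → List (ℕ × ℕ) :=
  mergeStep (PairTwins p) (pairMerge p)

section Coupling

variable [Fintype V] {G : SimpleGraph V}

open Classical in
/-- The sets that are compared when twins are merged greedily, starting from `L`. -/
noncomputable def comparedSets (G : SimpleGraph V) (L : List (Finset V)) : Finset (Finset V) :=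
  (Finset.range (L.length + 1)).biUnion fun t =>
    ((setStep G)^[t] L).toFinset.biUnion fun A => {A, outer G A, outer G A ∪ A}

theorem card_comparedSets_le (G : SimpleGraph V) (L : List (Finset V)) :
    (comparedSets G L).card ≤ (L.length + 1) * (L.length * 3) := by
  classical
  refine (Finset.card_biUnion_le_card_mul _ _ (L.length * 3) fun t _ => ?_).trans (by simp)
  refine (Finset.card_biUnion_le_card_mul _ _ 3 fun A _ => Finset.card_le_three).trans ?_
  exact Nat.mul_le_mul_right _
    ((List.toFinset_card_le _).trans (length_iterate_mergeStep_le _ _ _ _))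

/-- The fingerprints of a set and of its outer neighbourhood. -/
noncomputable def fingerprintPair (p x : ℕ) (id : V → ℕ) (G : SimpleGraph V) (A : Finset V) :
    ℕ × ℕ :=
  (fingerprint p x id A, fingerprint p x id (outer G A))

theorem disjoint_outer (A : Finset V) : Disjoint (outer G A) A :=
  Finset.disjoint_left.2 fun _ h => (mem_outer.1 h).1

/-- Merging tests entries for equality, so distinct classes need distinct pairs. This is why
`comparedSets` contains the classes themselves. -/
theorem fingerprintPair_injOn {p x : ℕ} {id : V → ℕ} {L : List (Finset V)} {t : ℕ}
    (ht : t ≤ L.length)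
    (hinj : Set.InjOn (fingerprint p x id) (comparedSets G L : Set (Finset V)))
    {A B : Finset V} (hA : A ∈ (setStep G)^[t] L) (hB : B ∈ (setStep G)^[t] L)
    (h : fingerprintPair p x id G A = fingerprintPair p x id G B) : A = B := by
  have hmem : ∀ A ∈ (setStep G)^[t] L, A ∈ comparedSets G L := fun A hA => by
    simp only [comparedSets, Finset.mem_biUnion, Finset.mem_range, List.mem_toFinset]
    exact ⟨t, by omega, A, hA, by simp⟩
  exact hinj (hmem A hA) (hmem B hB) (congrArg Prod.fst h)

/-- When the fingerprints separate the compared sets, merging on fingerprints simulates merging on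
sets. -/
theorem iterate_pairStep_map {p x : ℕ} (hp : 0 < p) {id : V → ℕ} {L : List (Finset V)}
    (hL : IsModulePartition G L)
    (hinj : Set.InjOn (fingerprint p x id) (comparedSets G L : Set (Finset V))) {t : ℕ}
    (ht : t ≤ L.length) :
    (pairStep p)^[t] (L.map (fingerprintPair p x id G)) =
      ((setStep G)^[t] L).map (fingerprintPair p x id G) := by
  classical
  induction t with
  | zero => rfl
  | succ t ih =>
    rw [Function.iterate_succ_apply', Function.iterate_succ_apply', ih (by omega)]
    have hpart := hL.iterate t
    have hmem : ∀ A ∈ (setStep G)^[t] L, ∀ S ∈ ({A, outer G A, outer G A ∪ A} : Finset _),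
        S ∈ comparedSets G L := fun A hA S hS => by
      simp only [comparedSets, Finset.mem_biUnion, Finset.mem_range, List.mem_toFinset]
      exact ⟨t, by omega, A, hA, hS⟩
    have hout : ∀ A ∈ (setStep G)^[t] L, ∀ B ∈ (setStep G)^[t] L,
        (fingerprint p x id (outer G A) = fingerprint p x id (outer G B) ↔
          outer G A = outer G B) := fun A hA B hB =>
      ⟨fun h => hinj (hmem A hA _ (by simp)) (hmem B hB _ (by simp)) h, fun h => h ▸ rfl⟩
    refine mergeStep_map ?_ ?_ ?_
    · exact fun A hA B hB h => fingerprintPair_injOn (by omega) hinj hA hB h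
    · intro A hA B hB _
      refine or_congr (hout A hA B hB) ?_
      simp only [fingerprintPair]
      rw [← fingerprint_union (disjoint_outer A), ← fingerprint_union (disjoint_outer B)]
      exact ⟨fun h => hinj (hmem A hA _ (by simp)) (hmem B hB _ (by simp)) h, fun h => by rw [h]⟩
    · intro A hA B hB hAB htw
      have hd := hpart.disjoint A hA B hB hAB
      simp only [pairMerge, fingerprintPair, hout A hA B hB]
      rw [← fingerprint_union hd]
      split_ifs with h
      · rw [outer_union_of_eq h]
      · obtain ⟨hBA, -, ho⟩ := outer_union_of_closed_eq hd (htw.resolve_left h)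
        rw [ho, ← fingerprint_sdiff hp hBA]

theorem isCograph_iff_pairs_merge [Nonempty V] {p x : ℕ} (hp : 0 < p) {id : V → ℕ}
    {L : List (Finset V)} (hL : IsModulePartition G L)
    (hinj : Set.InjOn (fingerprint p x id) (comparedSets G L : Set (Finset V))) :
    IsCograph G ↔
      ∀ s ∈ (pairStep p)^[L.length] (L.map (fingerprintPair p x id G)),
      ∀ t ∈ (pairStep p)^[L.length] (L.map (fingerprintPair p x id G)), s = t := by
  rw [isCograph_iff_merges hL, iterate_pairStep_map hp hL hinj le_rfl]
  simp only [List.forall_mem_map]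
  exact ⟨fun h A hA B hB => congrArg _ (h A hA B hB),
    fun h A hA B hB => fingerprintPair_injOn le_rfl hinj hA hB (h A hA B hB)⟩

open Classical in
/-- The singletons with identifiers less than `b`, ordered by identifiers. -/
noncomputable def singletonList (id : V → ℕ) (b : ℕ) : List (Finset V) :=
  (List.range b).flatMap fun i =>
    if ∃ v, id v = i then [Finset.univ.filter fun v => id v = i] else []

theorem isModulePartition_singletonList {id : V → ℕ} (hid : Function.Injective id) {b : ℕ}
    (hb : ∀ v, id v < b) : IsModulePartition G (singletonList id b) := by
  classical
  have hfib : ∀ v, (Finset.univ.filter fun u => id u = id v) = {v} := fun v => by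
    ext u; simp [hid.eq_iff]
  refine isModulePartition_singletons (fun A hA => ?_) (fun v => ?_)
  · simp only [singletonList, List.mem_flatMap] at hA
    obtain ⟨i, -, hA⟩ := hA
    split_ifs at hA with h
    · obtain ⟨v, rfl⟩ := h
      exact ⟨v, by rw [List.mem_singleton.1 hA, hfib]⟩
    · simp at hA
  · simp only [singletonList, List.mem_flatMap]
    exact ⟨id v, List.mem_range.2 (hb v), by rw [if_pos ⟨v, rfl⟩, hfib]; simp⟩

theorem length_singletonList_le (id : V → ℕ) (b : ℕ) :
    (singletonList id b).length ≤ Fintype.card V := by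
  classical
  have h1 : (singletonList id b).length =
      ((List.range b).filter fun i => decide (∃ v, id v = i)).length := by
    rw [← flatMap_ite_singleton, singletonList, List.length_flatMap, List.length_flatMap]
    refine congrArg List.sum (List.map_congr_left fun i _ => ?_)
    split_ifs <;> rfl
  rw [h1, ← List.toFinset_card_of_nodup (List.nodup_range.filter _)]
  refine (Finset.card_le_card (t := Finset.univ.image id) fun i hi => ?_).trans
    Finset.card_image_le
  simpa using (List.mem_filter.1 (List.mem_toFinset.1 hi)).2

open Classical in
/-- The fingerprint data that satisfy `R`, ordered by identifiers. -/
noncomputable def dataList (p x b : ℕ) (R : ℕ → ℕ → Prop) : List (ℕ × ℕ) :=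
  (List.range b).flatMap fun i => (List.range b).flatMap fun y =>
    if R i y then [(x ^ i % p, y)] else []

/-- Scanning all candidates in a fixed order makes the list depend only on which data are present,
not on the order or the repetitions in which they arrive. The bound `p ≤ b` ensures that the scan
reaches every fingerprint. -/
theorem dataList_eq_map {p x b : ℕ} {id : V → ℕ} (hid : Function.Injective id)
    {R : ℕ → ℕ → Prop}
    (hR : ∀ i y, R i y ↔ ∃ v, id v = i ∧ fingerprint p x id (outer G {v}) = y)
    (hp : 0 < p) (hpb : p ≤ b) :
    dataList p x b R = (singletonList id b).map (fingerprintPair p x id G) := by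
  classical
  rw [dataList, singletonList, List.map_flatMap]
  refine List.flatMap_congr fun i _ => ?_
  split_ifs with h
  · obtain ⟨v, rfl⟩ := h
    have hfib : (Finset.univ.filter fun u => id u = id v) = {v} := by
      ext u; simp [hid.eq_iff]
    have hR' : ∀ y, R (id v) y ↔ y = fingerprint p x id (outer G {v}) := fun y => by
      rw [hR]
      constructor
      · rintro ⟨u, hu, rfl⟩
        rw [hid hu]
      · exact fun h => ⟨v, rfl, h.symm⟩
    have key : ∀ (l : List ℕ), l.Nodup → ∀ z ∈ l,
        (l.flatMap fun y => if y = z then [(x ^ id v % p, y)] else []) = [(x ^ id v % p, z)] := by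
      intro l hl z hz
      induction l with
      | nil => simp at hz
      | cons a l ih =>
        rw [List.nodup_cons] at hl
        rw [List.flatMap_cons]
        by_cases haz : a = z
        · subst haz
          have : (l.flatMap fun y => if y = a then [(x ^ id v % p, y)] else []) = [] := by
            refine List.flatMap_eq_nil_iff.2 fun y hy => if_neg ?_
            rintro rfl
            exact hl.1 hy
          simp [this]
        · rw [if_neg haz, List.nil_append]
          exact ih hl.2 ((List.mem_cons.1 hz).resolve_left (Ne.symm haz))
    simp only [hR', hfib, List.map_singleton, fingerprintPair]
    rw [key _ List.nodup_range _ (List.mem_range.2 ((fingerprint_lt hp).trans_le hpb))]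
    simp [fingerprint]
  · rw [List.map_nil, List.flatMap_eq_nil_iff]
    refine fun y _ => if_neg fun hy => h ?_
    obtain ⟨v, hv, -⟩ := (hR _ _).1 hy
    exact ⟨v, hv⟩

end Coupling

end Cograph

/-! ### The local checks and the verifier -/

namespace Cograph

/-- The number with the given binary digits, the least significant one first. -/
def bitsVal (l : List Bool) : ℕ := l.foldr (fun b n => b.toNat + 2 * n) 0

/-- The `j`-th digit of `m` in base `2 ^ w`. -/
def field (w j m : ℕ) : ℕ := m / 2 ^ (w * j) % 2 ^ w

open Classical in
/-- The least prime of binary length `w`. -/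
noncomputable def hashPrime (w : ℕ) : ℕ :=
  ((List.range (2 ^ w)).flatMap fun q => if 2 ^ (w - 1) ≤ q ∧ q.Prime then [q] else []).headI

/-- Merging apparent twins greedily leaves at most one element. -/
def MergesToOne (p : ℕ) (l : List (ℕ × ℕ)) : Prop :=
  ∀ s ∈ (pairStep p)^[l.length] l, ∀ t ∈ (pairStep p)^[l.length] l, s = t

/-- The identifier `i` with the fingerprint `y` is the own datum, or the copied one, in the
certificate `m`. -/
def Carries (w i y m : ℕ) : Prop :=
  (field w 1 m = i ∧ field w 2 m = y) ∨ (field w 3 m = i ∧ field w 4 m = y)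

/-- The local check at the node with identifier `i` and certificate `m`, when its neighbours have
the certificates `M`. The fields of a certificate are the identifier of a leader, the identifier
of the node with the fingerprint of its neighbourhood, and a copy of such a pair of another node. -/
def NodeCheck (w p x i m : ℕ) (M : Multiset ℕ) : Prop :=
  field w 1 m = i ∧
  field w 2 m = (M.map fun m' => x ^ field w 1 m').sum % p ∧
  (∀ m' ∈ M, field w 0 m' = field w 0 m) ∧
  ((field w 3 m = field w 1 m ∧ field w 4 m = field w 2 m) ∨
    ((∃ m' ∈ M, field w 3 m = field w 1 m' ∧ field w 4 m = field w 2 m') ∧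
      ∃ m' ∈ M, field w 1 m' = field w 0 m)) ∧
  (i = field w 0 m ∨ (∃ m' ∈ M, field w 1 m' = field w 0 m) ∨ ∃ m' ∈ M, field w 3 m' = i) ∧
  (¬ i = field w 0 m ∨
    MergesToOne p (dataList p x (2 ^ w) fun i y => Carries w i y m ∨ ∃ m' ∈ M, Carries w i y m'))

/-- The number of bits of a field, when the random string is `r`. -/
def fieldWidth (r : List Bool) : ℕ := r.length / 5

/-- The evaluation point of the fingerprints, when the random string is `r`. -/
noncomputable def evalPoint (r : List Bool) : ℕ := bitsVal r % hashPrime (fieldWidth r)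

/-! ### Computability of the verifier -/

section Primrec

open Primrec

variable {α β γ : Type*} [Primcodable α] [Primcodable β] [Primcodable γ]

theorem primrec_pow : Primrec₂ ((· ^ ·) : ℕ → ℕ → ℕ) :=
  Primrec₂.unpaired'.1 Nat.Primrec.pow

theorem primrecPred_exists_mem {f : α → List β} {p : α → β → Prop} (hf : Primrec f)
    (hp : PrimrecPred fun q : α × β => p q.1 q.2) : PrimrecPred fun a => ∃ b ∈ f a, p a b :=
  (PrimrecRel.exists_mem_list (R := fun b a => p a b)
    (hp.comp (pair snd fst)).primrecRel).comp hf .id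

theorem primrecPred_forall_mem {f : α → List β} {p : α → β → Prop} (hf : Primrec f)
    (hp : PrimrecPred fun q : α × β => p q.1 q.2) : PrimrecPred fun a => ∀ b ∈ f a, p a b :=
  (PrimrecRel.forall_mem_list (R := fun b a => p a b)
    (hp.comp (pair snd fst)).primrecRel).comp hf .id

theorem primrec_flatMap_ite {f : α → List β} {p : α → β → Prop} [∀ a, DecidablePred (p a)]
    {g : α → β → γ} (hf : Primrec f)
    (hp : PrimrecPred fun q : α × β => p q.1 q.2) (hg : Primrec fun q : α × β => g q.1 q.2) :
    Primrec fun a => (f a).flatMap fun b => if p a b then [g a b] else [] :=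
  list_flatMap hf (Primrec₂.mk (Primrec.ite hp (list_cons.comp hg (.const [])) (.const [])))

theorem primrec_sum_map {f : α → List β} {g : α → β → ℕ} (hf : Primrec f)
    (hg : Primrec fun q : α × β => g q.1 q.2) : Primrec fun a => ((f a).map (g a)).sum := by
  refine (list_foldr (f := fun a => (f a).map (g a)) (g := fun _ => 0)
    (h := fun _ q => q.1 + q.2) (list_map hf hg.to₂) (.const 0)
    (nat_add.comp (fst.comp snd) (snd.comp snd)).to₂).of_eq fun a => ?_
  rw [List.sum_eq_foldr]

theorem primrec_mergeStep {f : α → List β} {tw : α → β → β → Prop} {mg : α → β → β → β}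
    (hf : Primrec f) (htw : PrimrecPred fun q : α × β × β => tw q.1 q.2.1 q.2.2)
    (hmg : Primrec fun q : α × β × β => mg q.1 q.2.1 q.2.2) :
    Primrec fun a => mergeStep (tw a) (mg a) (f a) := by
  classical
  have hpairs : Primrec fun a => twinPairs (tw a) (f a) := by
    refine list_flatMap hf (Primrec₂.mk ?_)
    refine primrec_flatMap_ite (f := fun q : α × β => f q.1)
      (p := fun q b => q.2 ≠ b ∧ tw q.1 q.2 b) (g := fun q b => (q.2, b)) (hf.comp fst) ?_ ?_
    · exact (Primrec.eq.comp (snd.comp fst) snd).not.and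
        (htw.comp (pair (fst.comp fst) (pair (snd.comp fst) snd)))
    · exact pair (snd.comp fst) snd
  refine (option_casesOn (list_head?.comp hpairs) hf
    (g := fun a q => mg a q.1 q.2 ::
      (f a).flatMap fun e => if e ≠ q.1 ∧ e ≠ q.2 then [e] else [])
    (Primrec₂.mk (list_cons.comp hmg ?_))).of_eq fun a => ?_
  · refine primrec_flatMap_ite (f := fun q : α × β × β => f q.1)
      (p := fun q e => e ≠ q.2.1 ∧ e ≠ q.2.2) (g := fun _ e => e) (hf.comp fst) ?_ snd
    exact (Primrec.eq.comp snd (fst.comp (snd.comp fst))).not.and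
      (Primrec.eq.comp snd (snd.comp (snd.comp fst))).not
  · simp only [mergeStep]
    cases (twinPairs (tw a) (f a)).head? <;> rfl

theorem primrec_pairStep : Primrec₂ pairStep := by
  refine Primrec.to₂ (primrec_mergeStep (f := fun q : ℕ × List (ℕ × ℕ) => q.2)
    (tw := fun q => PairTwins q.1) (mg := fun q => pairMerge q.1) snd ?_ ?_)
  · refine (Primrec.eq.comp (snd.comp (fst.comp snd)) (snd.comp (snd.comp snd))).or
      (Primrec.eq.comp ?_ ?_)
    · exact nat_mod.comp (nat_add.comp (snd.comp (fst.comp snd)) (fst.comp (fst.comp snd)))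
        (fst.comp fst)
    · exact nat_mod.comp (nat_add.comp (snd.comp (snd.comp snd)) (fst.comp (snd.comp snd)))
        (fst.comp fst)
  · refine pair (nat_mod.comp (nat_add.comp (fst.comp (fst.comp snd)) (fst.comp (snd.comp snd)))
        (fst.comp fst)) (Primrec.ite
      (Primrec.eq.comp (snd.comp (fst.comp snd)) (snd.comp (snd.comp snd)))
      (snd.comp (fst.comp snd)) ?_)
    exact nat_mod.comp (nat_add.comp (snd.comp (fst.comp snd))
      (nat_mul.comp (nat_sub.comp (fst.comp fst) (.const 1)) (fst.comp (snd.comp snd))))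
      (fst.comp fst)

theorem primrecPred_mergesToOne {p : α → ℕ} {l : α → List (ℕ × ℕ)} (hp : Primrec p)
    (hl : Primrec l) : PrimrecPred fun a => MergesToOne (p a) (l a) := by
  have hit : Primrec fun a => (pairStep (p a))^[(l a).length] (l a) :=
    nat_iterate (list_length.comp hl) hl (primrec_pairStep.comp (hp.comp fst) snd).to₂
  refine primrecPred_forall_mem hit (p := fun a s =>
    ∀ t ∈ (pairStep (p a))^[(l a).length] (l a), s = t) ?_
  exact primrecPred_forall_mem (f := fun q : α × ℕ × ℕ =>
      (pairStep (p q.1))^[(l q.1).length] (l q.1)) (p := fun q t => q.2 = t) (hit.comp fst)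
    (Primrec.eq.comp (snd.comp fst) snd)

theorem primrec_field {w m : α → ℕ} (hw : Primrec w) (j : ℕ) (hm : Primrec m) :
    Primrec fun a => field (w a) j (m a) :=
  nat_mod.comp (nat_div.comp hm (primrec_pow.comp (.const 2) (nat_mul.comp hw (.const j))))
    (primrec_pow.comp (.const 2) hw)

theorem primrec_dataList {p x b : α → ℕ} {R : α → ℕ → ℕ → Prop} (hp : Primrec p) (hx : Primrec x)
    (hb : Primrec b) (hR : PrimrecPred fun q : α × ℕ × ℕ => R q.1 q.2.1 q.2.2) :
    Primrec fun a => dataList (p a) (x a) (b a) (R a) := by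
  classical
  refine list_flatMap (list_range.comp hb) (Primrec₂.mk ?_)
  refine primrec_flatMap_ite (f := fun q : α × ℕ => List.range (b q.1))
    (p := fun q y => R q.1 q.2 y) (g := fun q y => (x q.1 ^ q.2 % p q.1, y))
    (list_range.comp (hb.comp fst)) ?_ ?_
  · exact hR.comp (pair (fst.comp fst) (pair (snd.comp fst) snd))
  · exact pair (nat_mod.comp (primrec_pow.comp (hx.comp (fst.comp fst)) (snd.comp fst))
      (hp.comp (fst.comp fst))) snd

theorem primrecPred_carries {w i y m : α → ℕ} (hw : Primrec w) (hi : Primrec i) (hy : Primrec y)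
    (hm : Primrec m) : PrimrecPred fun a => Carries (w a) (i a) (y a) (m a) :=
  ((Primrec.eq.comp (primrec_field hw 1 hm) hi).and (Primrec.eq.comp (primrec_field hw 2 hm) hy)).or
    ((Primrec.eq.comp (primrec_field hw 3 hm) hi).and
      (Primrec.eq.comp (primrec_field hw 4 hm) hy))

theorem primrecPred_nodeCheck {w p x i m : α → ℕ} {l : α → List ℕ} (hw : Primrec w)
    (hp : Primrec p) (hx : Primrec x) (hi : Primrec i) (hm : Primrec m) (hl : Primrec l) :
    PrimrecPred fun a => NodeCheck (w a) (p a) (x a) (i a) (m a) (l a) := by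
  have hF : ∀ j, Primrec fun a => field (w a) j (m a) := fun j => primrec_field hw j hm
  have hF1 : ∀ j, Primrec fun q : α × ℕ => field (w q.1) j (m q.1) := fun j => (hF j).comp fst
  have hF2 : ∀ j, Primrec fun q : α × ℕ => field (w q.1) j q.2 := fun j =>
    primrec_field (hw.comp fst) j snd
  have hleader : PrimrecPred fun a => ∃ m' ∈ l a, field (w a) 1 m' = field (w a) 0 (m a) :=
    primrecPred_exists_mem (p := fun a m' => field (w a) 1 m' = field (w a) 0 (m a)) hl
      (Primrec.eq.comp (hF2 1) (hF1 0))
  have hall : PrimrecPred fun a => ∀ m' ∈ l a, field (w a) 0 m' = field (w a) 0 (m a) :=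
    primrecPred_forall_mem (p := fun a m' => field (w a) 0 m' = field (w a) 0 (m a)) hl
      (Primrec.eq.comp (hF2 0) (hF1 0))
  have hcopy : PrimrecPred fun a => ∃ m' ∈ l a, field (w a) 3 (m a) = field (w a) 1 m' ∧
      field (w a) 4 (m a) = field (w a) 2 m' :=
    primrecPred_exists_mem (p := fun a m' => field (w a) 3 (m a) = field (w a) 1 m' ∧
        field (w a) 4 (m a) = field (w a) 2 m') hl
      ((Primrec.eq.comp (hF1 3) (hF2 1)).and (Primrec.eq.comp (hF1 4) (hF2 2)))
  have hcopied : PrimrecPred fun a => ∃ m' ∈ l a, field (w a) 3 m' = i a :=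
    primrecPred_exists_mem (p := fun a m' => field (w a) 3 m' = i a) hl
      (Primrec.eq.comp (hF2 3) (hi.comp fst))
  have hsum : Primrec fun a => ((l a).map fun m' => x a ^ field (w a) 1 m').sum :=
    primrec_sum_map (g := fun a m' => x a ^ field (w a) 1 m') hl
      (primrec_pow.comp (hx.comp fst) (hF2 1))
  have hdata : Primrec fun a => dataList (p a) (x a) (2 ^ w a) fun i y =>
      Carries (w a) i y (m a) ∨ ∃ m' ∈ l a, Carries (w a) i y m' := by
    refine primrec_dataList hp hx (primrec_pow.comp (.const 2) hw) ?_
    refine (primrecPred_carries (hw.comp fst) (fst.comp snd) (snd.comp snd) (hm.comp fst)).or ?_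
    exact primrecPred_exists_mem (f := fun q : α × ℕ × ℕ => l q.1)
      (p := fun q m' => Carries (w q.1) q.2.1 q.2.2 m') (hl.comp fst)
      (primrecPred_carries (hw.comp (fst.comp fst)) (fst.comp (snd.comp fst))
        (snd.comp (snd.comp fst)) snd)
  have hisLeader : PrimrecPred fun a => i a = field (w a) 0 (m a) := Primrec.eq.comp hi (hF 0)
  refine PrimrecPred.of_eq ((Primrec.eq.comp (hF 1) hi).and
    ((Primrec.eq.comp (hF 2) (nat_mod.comp hsum hp)).and (hall.and
      ((((Primrec.eq.comp (hF 3) (hF 1)).and (Primrec.eq.comp (hF 4) (hF 2))).or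
        (hcopy.and hleader)).and
      ((hisLeader.or (hleader.or hcopied)).and
        (hisLeader.not.or (primrecPred_mergesToOne hp hdata))))))) fun a => ?_
  simp only [NodeCheck, Multiset.mem_coe, Multiset.map_coe, Multiset.sum_coe]

theorem primrec_bitsVal : Primrec bitsVal :=
  list_foldr .id (.const 0) (nat_add.comp ((dom_bool Bool.toNat).comp (fst.comp snd))
    (nat_mul.comp (.const 2) (snd.comp snd))).to₂

theorem primrecPred_prime : PrimrecPred Nat.Prime := by
  have h : PrimrecPred fun q : ℕ => 2 ≤ q ∧ ∀ m ∈ List.range q, ¬ q % m = 0 ∨ m = 1 := by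
    refine (nat_le.comp (.const 2) .id).and (primrecPred_forall_mem
      (p := fun q m => ¬ q % m = 0 ∨ m = 1) list_range ?_)
    exact (Primrec.eq.comp (nat_mod.comp fst snd) (.const 0)).not.or
      (Primrec.eq.comp snd (.const 1))
  refine h.of_eq fun q => ?_
  rw [Nat.prime_def_lt]
  simp only [List.mem_range, Nat.dvd_iff_mod_eq_zero, imp_iff_not_or]

theorem primrec_hashPrime : Primrec hashPrime := by
  classical
  refine list_headI.comp (primrec_flatMap_ite (f := fun w => List.range (2 ^ w))
    (p := fun w q => 2 ^ (w - 1) ≤ q ∧ q.Prime) (g := fun _ q => q)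
    (list_range.comp (primrec_pow.comp (.const 2) .id)) ?_ snd)
  exact (nat_le.comp (primrec_pow.comp (.const 2) (nat_sub.comp fst (.const 1))) snd).and
    (primrecPred_prime.comp snd)

theorem primrec_fieldWidth : Primrec fieldWidth := nat_div.comp list_length (.const 5)

theorem primrec_evalPoint : Primrec evalPoint :=
  nat_mod.comp primrec_bitsVal (primrec_hashPrime.comp primrec_fieldWidth)

end Primrec

open Classical in
/-- The verifier for cographs. -/
noncomputable def cographVerifier : Verifier where
  -- A certificate of the wrong length is not forwarded, which bounds the messages against every
  -- prover; its node rejects anyway.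
  message _ r c := if c.length = r.length then c else []
  output i r c M := decide (c.length = r.length ∧
    NodeCheck (fieldWidth r) (hashPrime (fieldWidth r)) (evalPoint r) i (bitsVal c)
      (M.map bitsVal))
  message_computable := by
    refine (Primrec.ite (Primrec.eq.comp ?_ ?_) ?_ (.const [])).to_comp
    · exact Primrec.list_length.comp (Primrec.snd.comp Primrec.snd)
    · exact Primrec.list_length.comp (Primrec.fst.comp Primrec.snd)
    · exact Primrec.snd.comp Primrec.snd
  output_computable := by
    have hr : Primrec fun a : ℕ × List Bool × List Bool × List (List Bool) => a.2.1 :=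
      Primrec.fst.comp Primrec.snd
    have hc : Primrec fun a : ℕ × List Bool × List Bool × List (List Bool) => a.2.2.1 :=
      Primrec.fst.comp (Primrec.snd.comp Primrec.snd)
    have hM : Primrec fun a : ℕ × List Bool × List Bool × List (List Bool) => a.2.2.2 :=
      Primrec.snd.comp (Primrec.snd.comp Primrec.snd)
    have hw := primrec_fieldWidth.comp hr
    have h := (Primrec.eq.comp (Primrec.list_length.comp hc) (Primrec.list_length.comp hr)).and
      (primrecPred_nodeCheck hw (primrec_hashPrime.comp hw) (primrec_evalPoint.comp hr)
        Primrec.fst (primrec_bitsVal.comp hc)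
        (Primrec.list_map hM (primrec_bitsVal.comp Primrec.snd).to₂))
    exact h.decide.to_comp

end Cograph

/-! ### Correctness of the local checks for a separating evaluation point -/

namespace Cograph

theorem field_zero_add_mul {w a : ℕ} (ha : a < 2 ^ w) (s : ℕ) : field w 0 (a + 2 ^ w * s) = a := by
  simp [field, Nat.mod_eq_of_lt ha]

theorem field_succ_add_mul {w a : ℕ} (ha : a < 2 ^ w) (j s : ℕ) :
    field w (j + 1) (a + 2 ^ w * s) = field w j s := by
  rw [field, field, Nat.mul_succ, Nat.add_comm (w * j), pow_add, ← Nat.div_div_eq_div_mul,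
    Nat.add_mul_div_left _ _ (by positivity), Nat.div_eq_of_lt ha, Nat.zero_add]

theorem exists_fields {w : ℕ} (a : ℕ → ℕ) (ha : ∀ j, a j < 2 ^ w) (n : ℕ) :
    ∃ m < 2 ^ (n * w), ∀ j < n, field w j m = a j := by
  induction n generalizing a with
  | zero => exact ⟨0, by simp, by simp⟩
  | succ n ih =>
    obtain ⟨s, hs, hf⟩ := ih (fun j => a (j + 1)) fun j => ha _
    refine ⟨a 0 + 2 ^ w * s, ?_, fun j hj => ?_⟩
    · rw [Nat.succ_mul, Nat.add_comm (n * w), pow_add]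
      calc a 0 + 2 ^ w * s < 2 ^ w + 2 ^ w * s := Nat.add_lt_add_right (ha 0) _
        _ = 2 ^ w * (s + 1) := by ring
        _ ≤ 2 ^ w * 2 ^ (n * w) := Nat.mul_le_mul_left _ hs
    · cases j with
      | zero => exact field_zero_add_mul (ha 0) s
      | succ j => rw [field_succ_add_mul (ha 0), hf j (by omega)]

theorem exists_bits (l : ℕ) (m : ℕ) (hm : m < 2 ^ l) :
    ∃ c : List Bool, c.length = l ∧ bitsVal c = m := by
  induction l generalizing m with
  | zero => exact ⟨[], rfl, by simp at hm; simp [hm, bitsVal]⟩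
  | succ l ih =>
    obtain ⟨c, hc, hv⟩ := ih (m / 2) (by rw [pow_succ] at hm; omega)
    refine ⟨decide (m % 2 = 1) :: c, by simp [hc], ?_⟩
    change (decide (m % 2 = 1)).toNat + 2 * bitsVal c = m
    rw [hv]
    rcases Nat.mod_two_eq_zero_or_one m with h | h <;> simp [h] <;> omega

variable {V : Type*} [Fintype V] {G : SimpleGraph V}

/-- In a connected cograph there is a vertex `a` such that the vertices that are not adjacent to
`a` can be matched with neighbours of them that are adjacent to `a`. -/
theorem exists_leader (hconn : G.Connected) (hG : IsCograph G) :
    ∃ (a : V) (κ : V → V), (∀ v, κ v = v ∨ G.Adj v (κ v) ∧ G.Adj v a) ∧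
      ∀ v, v = a ∨ G.Adj v a ∨ ∃ u, G.Adj v u ∧ κ u = v := by
  classical
  have := hconn.nonempty
  rcases Nat.lt_or_ge (Fintype.card V) 2 with hn | hn
  · have : Subsingleton V := Fintype.card_le_one_iff_subsingleton.1 (by omega)
    exact ⟨Classical.arbitrary V, id, fun v => .inl rfl, fun v => .inl (Subsingleton.elim _ _)⟩
  obtain ⟨A, B, h⟩ := exists_isSplit G Finset.univ ((isCograph_iff G).1 hG) hn
  have hAB : ∀ a ∈ A, ∀ b ∈ B, G.Adj a b := by
    refine h.uniform.resolve_left fun hanti => ?_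
    obtain ⟨a, ha⟩ := h.left
    obtain ⟨b, hb⟩ := h.right
    have key : ∀ u v, G.Walk u v → u ∈ A → v ∈ A := by
      intro u v q
      induction q with
      | nil => exact id
      | @cons u v _ huv _ ih =>
        exact fun hu => ih (((h.mem_iff v).1 (Finset.mem_univ v)).resolve_right
          fun hv => hanti u hu v hv huv)
    obtain ⟨q⟩ := hconn.preconnected a b
    exact Finset.disjoint_left.1 h.disjoint (key a b q ha) hb
  -- The leader `a` is any vertex of the smaller side `B`, and `f` injects `B` into `A`. The vertex
  -- `f b` is adjacent to both `b` and `a`, so it can carry the copy for `b`: `κ` inverts `f` on its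
  -- image and fixes all other vertices.
  have main : ∀ A B : Finset V, B.Nonempty → (∀ v, v ∈ A ∨ v ∈ B) →
      (∀ a ∈ A, ∀ b ∈ B, G.Adj a b) → B.card ≤ A.card →
      ∃ (a : V) (κ : V → V), (∀ v, κ v = v ∨ G.Adj v (κ v) ∧ G.Adj v a) ∧
        ∀ v, v = a ∨ G.Adj v a ∨ ∃ u, G.Adj v u ∧ κ u = v := by
    rintro A B ⟨a, ha⟩ hcover hAB hcard
    obtain ⟨f⟩ : Nonempty (B ↪ A) :=
      Function.Embedding.nonempty_of_card_le (by simpa using hcard)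
    have hex : ∀ u, ∃ k : V, (∃ b : B, (f b : V) = u ∧ k = b) ∨ (k = u ∧ ∀ b : B, (f b : V) ≠ u) := by
      intro u
      by_cases hu : ∃ b : B, (f b : V) = u
      · obtain ⟨b, hb⟩ := hu
        exact ⟨b, .inl ⟨b, hb, rfl⟩⟩
      · push Not at hu
        exact ⟨u, .inr ⟨rfl, hu⟩⟩
    choose κ hκ using hex
    refine ⟨a, κ, fun v => ?_, fun v => ?_⟩
    · rcases hκ v with ⟨b, rfl, hb⟩ | ⟨hv, -⟩
      · rw [hb]
        exact .inr ⟨hAB _ (f b).2 _ b.2, hAB _ (f b).2 _ ha⟩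
      · exact .inl hv
    · rcases hcover v with hv | hv
      · exact .inr (.inl (hAB v hv a ha))
      · refine .inr (.inr ⟨f ⟨v, hv⟩, (hAB _ (f ⟨v, hv⟩).2 v hv).symm, ?_⟩)
        rcases hκ (f ⟨v, hv⟩ : V) with ⟨b, hb, hk⟩ | ⟨-, hk⟩
        · rw [hk, f.injective (Subtype.ext hb)]
        · exact (hk ⟨v, hv⟩ rfl).elim
  rcases le_total B.card A.card with hcard | hcard
  · exact main A B h.right (fun v => (h.mem_iff v).1 (Finset.mem_univ v)) hAB hcard
  · exact main B A h.left (fun v => ((h.mem_iff v).1 (Finset.mem_univ v)).symm)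
      (fun b hb a ha => (hAB a ha b hb).symm) hcard

open Classical in
/-- The certificates of the neighbours of `v`. -/
noncomputable def nbrCerts (G : SimpleGraph V) (m : V → ℕ) (v : V) : Multiset ℕ :=
  (Finset.univ.filter fun u => G.Adj v u).val.map m

theorem exists_mem_nbrCerts {m : V → ℕ} {v : V} {P : ℕ → Prop} :
    (∃ m' ∈ nbrCerts G m v, P m') ↔ ∃ u, G.Adj v u ∧ P (m u) := by
  simp [nbrCerts]

theorem forall_mem_nbrCerts {m : V → ℕ} {v : V} {P : ℕ → Prop} :
    (∀ m' ∈ nbrCerts G m v, P m') ↔ ∀ u, G.Adj v u → P (m u) := by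
  simp [nbrCerts]

theorem outer_singleton [DecidableRel G.Adj] (v : V) :
    outer G {v} = Finset.univ.filter fun u => G.Adj v u := by
  ext u
  simp only [mem_outer, Finset.mem_singleton, exists_eq_left, Finset.mem_filter, Finset.mem_univ,
    true_and, and_iff_right_iff_imp]
  exact fun h => h.ne'

theorem sum_map_nbrCerts {m : V → ℕ} {id : V → ℕ} {w p x : ℕ}
    (hid : ∀ v, field w 1 (m v) = id v) (v : V) :
    ((nbrCerts G m v).map fun m' => x ^ field w 1 m').sum % p =
      fingerprint p x id (outer G {v}) := by
  classical
  simp only [nbrCerts, Multiset.map_map, Function.comp_def, hid, fingerprint, outer_singleton]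
  rfl

/-- If all nodes accept, and the fingerprints separate the compared sets, then the leader decides
correctly. -/
theorem isCograph_of_nodeCheck {w p x : ℕ} {id m : V → ℕ} (hconn : G.Connected)
    (hid : Function.Injective id) (hb : ∀ v, id v < 2 ^ w) (hp : 0 < p) (hpb : p ≤ 2 ^ w)
    (hinj : Set.InjOn (fingerprint p x id)
      (comparedSets G (singletonList id (2 ^ w)) : Set (Finset V)))
    (h : ∀ v, NodeCheck w p x (id v) (m v) (nbrCerts G m v)) : IsCograph G := by
  have := hconn.nonempty
  have h1 : ∀ v, field w 1 (m v) = id v := fun v => (h v).1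
  have h2 : ∀ v, field w 2 (m v) = fingerprint p x id (outer G {v}) := fun v => by
    rw [(h v).2.1, sum_map_nbrCerts h1]
  have hconst : ∀ u v, field w 0 (m u) = field w 0 (m v) := by
    have key : ∀ u v, G.Walk u v → field w 0 (m u) = field w 0 (m v) := by
      intro u v q
      induction q with
      | nil => rfl
      | @cons u v _ huv _ ih =>
        exact (forall_mem_nbrCerts.1 (h u).2.2.1 v huv).symm.trans ih
    intro u v
    obtain ⟨q⟩ := hconn.preconnected u v
    exact key u v q
  have hcopy : ∀ v, field w 3 (m v) = id v ∧ field w 4 (m v) = field w 2 (m v) ∨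
      (∃ u, G.Adj v u ∧ field w 3 (m v) = id u ∧ field w 4 (m v) = field w 2 (m u)) ∧
        ∃ u, G.Adj v u ∧ id u = field w 0 (m v) := by
    intro v
    have := (h v).2.2.2.1
    simpa only [exists_mem_nbrCerts, h1] using this
  have hreach : ∀ v, id v = field w 0 (m v) ∨ (∃ u, G.Adj v u ∧ id u = field w 0 (m v)) ∨
      ∃ u, G.Adj v u ∧ field w 3 (m u) = id v := by
    intro v
    have := (h v).2.2.2.2.1
    simpa only [exists_mem_nbrCerts, h1] using this
  -- A neighbour `u` of `v` that shows the identifier of `v` cannot be repeating its own datum. It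
  -- therefore copies a neighbour with that identifier, which is `v`, and it is adjacent to the
  -- leader.
  have hcopied : ∀ u v, G.Adj v u → field w 3 (m u) = id v →
      field w 4 (m u) = field w 2 (m v) ∧ ∃ a, G.Adj u a ∧ id a = field w 0 (m u) := by
    intro u v hvu h3
    rcases hcopy u with hc | ⟨⟨z, hz, hz3, hz4⟩, ha⟩
    · exact (hvu.ne (hid (h3.symm.trans hc.1))).elim
    · rw [hid (h3.symm.trans hz3)]
      exact ⟨hz4, ha⟩
  -- Merlin might announce a leader that does not exist; the visibility check at any single node
  -- rules this out.
  obtain ⟨a, ha⟩ : ∃ a, id a = field w 0 (m a) := by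
    obtain ⟨v⟩ := ‹Nonempty V›
    rcases hreach v with hv | ⟨u, -, hu⟩ | ⟨u, hvu, hu⟩
    · exact ⟨v, hv⟩
    · exact ⟨u, hu.trans (hconst v u)⟩
    · obtain ⟨-, a, -, ha⟩ := hcopied u v hvu hu
      exact ⟨a, ha.trans (hconst u a)⟩
  have hlead : ∀ u z, id u = field w 0 (m z) → u = a := fun u z hu =>
    hid (hu.trans ((hconst z a).trans ha.symm))
  have hmerge := (h a).2.2.2.2.2.resolve_left (fun hna => hna ha)
  have htrue : ∀ u i y, Carries w i y (m u) →
      ∃ v, id v = i ∧ fingerprint p x id (outer G {v}) = y := by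
    rintro u i y (⟨rfl, rfl⟩ | ⟨rfl, rfl⟩)
    · exact ⟨u, (h1 u).symm, (h2 u).symm⟩
    · rcases hcopy u with hc | ⟨⟨z, -, hz3, hz4⟩, -⟩
      · exact ⟨u, hc.1.symm, by rw [hc.2, h2]⟩
      · exact ⟨z, hz3.symm, by rw [hz4, h2]⟩
  rw [dataList_eq_map (G := G) hid (fun i y => ?_) hp hpb, MergesToOne, List.length_map,
    ← isCograph_iff_pairs_merge hp (isModulePartition_singletonList hid hb) hinj] at hmerge
  · exact hmerge
  · rw [exists_mem_nbrCerts]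
    constructor
    · rintro (hc | ⟨u, -, hc⟩)
      · exact htrue a i y hc
      · exact htrue u i y hc
    · rintro ⟨v, rfl, rfl⟩
      -- Every node is the leader, a neighbour of the leader, or copied by a neighbour of the
      -- leader, so its datum is in view.
      rcases hreach v with hv | ⟨u, hvu, hu⟩ | ⟨u, hvu, hu⟩
      · rw [hlead v v hv]
        exact .inl (.inl ⟨h1 a, h2 a⟩)
      · rw [hlead u v hu] at hvu
        exact .inr ⟨v, hvu.symm, .inl ⟨h1 v, h2 v⟩⟩
      · obtain ⟨hu4, z, huz, hz⟩ := hcopied u v hvu hu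
        rw [hlead z u hz] at huz
        exact .inr ⟨u, huz.symm, .inr ⟨hu, hu4.trans (h2 v)⟩⟩

/-- On connected cographs there are certificates that all nodes accept, if the fingerprints
separate the compared sets. -/
theorem exists_nodeCheck {w p : ℕ} {id : V → ℕ} (hconn : G.Connected)
    (hid : Function.Injective id) (hb : ∀ v, id v < 2 ^ w) (hp : 0 < p) (hpb : p ≤ 2 ^ w)
    (hG : IsCograph G) (x : ℕ) :
    ∃ m : V → ℕ, (∀ v, m v < 2 ^ (5 * w)) ∧
      (Set.InjOn (fingerprint p x id)
        (comparedSets G (singletonList id (2 ^ w)) : Set (Finset V)) →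
        ∀ v, NodeCheck w p x (id v) (m v) (nbrCerts G m v)) := by
  have := hconn.nonempty
  obtain ⟨a, κ, hκ, hreach⟩ := exists_leader hconn hG
  let fp : V → ℕ := fun v => fingerprint p x id (outer G {v})
  have hfp : ∀ v, fp v < 2 ^ w := fun v => (fingerprint_lt hp).trans_le hpb
  have hex : ∀ v, ∃ m < 2 ^ (5 * w), field w 0 m = id a ∧ field w 1 m = id v ∧
      field w 2 m = fp v ∧ field w 3 m = id (κ v) ∧ field w 4 m = fp (κ v) := by
    intro v
    obtain ⟨m, hm, hf⟩ := exists_fields (w := w)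
      (fun j => match j with
        | 0 => id a | 1 => id v | 2 => fp v | 3 => id (κ v) | _ => fp (κ v))
      (fun j => by
        rcases j with _ | _ | _ | _ | j
        exacts [hb a, hb v, hfp v, hb (κ v), hfp (κ v)]) 5
    exact ⟨m, hm, hf 0 (by omega), hf 1 (by omega), hf 2 (by omega), hf 3 (by omega),
      hf 4 (by omega)⟩
  choose m hm h0 h1 h2 h3 h4 using hex
  refine ⟨m, hm, fun hinj v => ⟨h1 v, ?_, ?_, ?_, ?_, ?_⟩⟩
  · rw [sum_map_nbrCerts h1, h2]
  · exact forall_mem_nbrCerts.2 fun u _ => by rw [h0, h0]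
  · simp only [exists_mem_nbrCerts, h0, h1, h2, h3, h4]
    rcases hκ v with hv | ⟨h5, h6⟩
    · simp [hv]
    · exact .inr ⟨⟨κ v, h5, rfl, rfl⟩, a, h6, rfl⟩
  · simp only [exists_mem_nbrCerts, h0, h1, h3]
    rcases hreach v with rfl | hv | ⟨u, hu, huv⟩
    · exact .inl rfl
    · exact .inr (.inl ⟨a, hv, rfl⟩)
    · exact .inr (.inr ⟨u, hu, by rw [huv]⟩)
  · rw [h0]
    refine or_iff_not_imp_left.2 fun hva => ?_
    obtain rfl : v = a := hid (not_not.1 hva)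
    rw [dataList_eq_map (G := G) hid (fun i y => ?_) hp hpb, MergesToOne, List.length_map,
      ← isCograph_iff_pairs_merge hp (isModulePartition_singletonList hid hb) hinj]
    · exact hG
    · simp only [exists_mem_nbrCerts, Carries, h1, h2, h3, h4]
      constructor
      · rintro ((h | h) | ⟨u, -, h | h⟩)
        exacts [⟨v, h⟩, ⟨κ v, h⟩, ⟨u, h⟩, ⟨κ u, h⟩]
      · rintro ⟨u, rfl, rfl⟩
        rcases hreach u with rfl | hu | ⟨z, hz, rfl⟩
        · exact .inl (.inl ⟨rfl, rfl⟩)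
        · exact .inr ⟨u, hu.symm, .inl ⟨rfl, rfl⟩⟩
        · rcases hκ z with hκz | ⟨-, hza⟩
          · exact (hz.ne hκz).elim
          · exact .inr ⟨z, hza.symm, .inr ⟨rfl, rfl⟩⟩

end Cograph

/-! ### Random evaluation points and the error probability -/

namespace Cograph

theorem bitsVal_lt (c : List Bool) : bitsVal c < 2 ^ c.length := by
  induction c with
  | nil => simp [bitsVal]
  | cons b c ih =>
    change b.toNat + 2 * bitsVal c < 2 ^ (c.length + 1)
    have := Bool.toNat_lt b
    rw [pow_succ]
    omega

theorem bitsVal_injective {c d : List Bool} (h : c.length = d.length)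
    (hv : bitsVal c = bitsVal d) : c = d := by
  induction c generalizing d with
  | nil => exact (List.length_eq_zero_iff.1 h.symm).symm
  | cons b c ih =>
    cases d with
    | nil => simp at h
    | cons b' d =>
      change b.toNat + 2 * bitsVal c = b'.toNat + 2 * bitsVal d at hv
      have h1 := Bool.toNat_lt b
      have h2 := Bool.toNat_lt b'
      have hb : b = b' := by
        cases b <;> cases b' <;> simp only [Bool.toNat_false, Bool.toNat_true] at hv <;>
          first | rfl | omega
      rw [ih (by simpa using h) (by omega), hb]

/-- Bertrand's postulate gives a prime above `2 ^ (w - 1)` and at most `2 ^ w`; the upper end is not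
prime because `2 ≤ w`. -/
theorem hashPrime_spec {w : ℕ} (hw : 2 ≤ w) :
    (hashPrime w).Prime ∧ 2 ^ (w - 1) ≤ hashPrime w ∧ hashPrime w < 2 ^ w := by
  classical
  obtain ⟨v, rfl⟩ : ∃ v, w = v + 1 := ⟨w - 1, by omega⟩
  have hmem : ∀ q, q ∈ ((List.range (2 ^ (v + 1))).flatMap fun q =>
      if 2 ^ (v + 1 - 1) ≤ q ∧ q.Prime then [q] else []) ↔
      q < 2 ^ (v + 1) ∧ 2 ^ (v + 1 - 1) ≤ q ∧ q.Prime := by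
    intro q
    rw [flatMap_ite_singleton]
    simp
  have hin : hashPrime (v + 1) ∈ ((List.range (2 ^ (v + 1))).flatMap fun q =>
      if 2 ^ (v + 1 - 1) ≤ q ∧ q.Prime then [q] else []) := by
    obtain ⟨q, hq, h1, h2⟩ := Nat.exists_prime_lt_and_le_two_mul (2 ^ v) (by positivity)
    have hne : q ≠ 2 ^ (v + 1) := by
      rintro rfl
      exact Nat.Prime.not_prime_pow (by omega) hq
    have hq' := (hmem q).2 ⟨by rw [pow_succ] at hne ⊢; omega, by simpa using h1.le, hq⟩
    have hhead : ∀ l : List ℕ, q ∈ l → l.headI ∈ l := by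
      intro l hl
      cases l with
      | nil => simp at hl
      | cons a l => simp
    exact hhead _ hq'
  obtain ⟨h1, h2, h3⟩ := (hmem _).1 hin
  exact ⟨h3, h2, h1⟩

open Classical in
/-- A random bit string hits a set of residues modulo `p` with probability at most about its
size divided by `p`. -/
theorem card_bits_mod_le {l p : ℕ} (S : Finset ℕ) :
    (Finset.univ.filter fun r : Fin l → Bool => bitsVal (List.ofFn r) % p ∈ S).card ≤
      S.card * (2 ^ l / p + 1) := by
  have hsub : (Finset.univ.filter fun r : Fin l → Bool => bitsVal (List.ofFn r) % p ∈ S) ⊆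
      S.biUnion fun b => Finset.univ.filter fun r : Fin l → Bool =>
        bitsVal (List.ofFn r) % p = b := by
    intro r hr
    simpa using hr
  refine (Finset.card_le_card hsub).trans (Finset.card_biUnion_le_card_mul _ _ _ fun b _ => ?_)
  rw [← Finset.card_range (2 ^ l / p + 1)]
  -- Among strings with the same residue, the quotient determines the string.
  refine Finset.card_le_card_of_injOn (fun r => bitsVal (List.ofFn r) / p) ?_ ?_
  · intro r _
    have := bitsVal_lt (List.ofFn r)
    rw [List.length_ofFn] at this
    simpa [Nat.lt_succ_iff] using Nat.div_le_div_right this.le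
  · intro r hr s hs h
    simp only [Finset.coe_filter, Finset.mem_univ, true_and, Set.mem_ofPred_eq] at hr hs
    refine List.ofFn_injective (bitsVal_injective (by simp) ?_)
    rw [← Nat.div_add_mod (bitsVal (List.ofFn r)) p, ← Nat.div_add_mod (bitsVal (List.ofFn s)) p,
      hr, hs]
    exact congrArg (fun z => p * z + b) h

open Classical in
theorem one_sub_min_le_card_div {l n c : ℕ} (hn : 0 < n) {Bad P : (Fin l → Bool) → Prop}
    [DecidablePred P] (hbad : (Finset.univ.filter Bad).card * (3 * n ^ c) ≤ 2 ^ l)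
    (h : ∀ r, ¬ Bad r → P r) :
    1 - min (1 / 3) (1 / (n : ℝ) ^ c) ≤ ((Finset.univ.filter P).card : ℝ) / 2 ^ l := by
  have hsum : 2 ^ l ≤ (Finset.univ.filter P).card + (Finset.univ.filter Bad).card := by
    have h1 := Finset.card_filter_add_card_filter_not (s := Finset.univ) P
    have h2 : (Finset.univ.filter fun r => ¬ P r).card ≤ (Finset.univ.filter Bad).card :=
      Finset.card_le_card fun r hr => by
        simp only [Finset.mem_filter, Finset.mem_univ, true_and] at hr ⊢
        exact not_not.1 fun hb => hr (h r hb)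
    have h3 : (Finset.univ : Finset (Fin l → Bool)).card = 2 ^ l := by simp
    omega
  have hnc : 1 ≤ n ^ c := Nat.one_le_pow _ _ hn
  have hb1 : (Finset.univ.filter Bad).card * 3 ≤ 2 ^ l := by nlinarith
  have hb2 : (Finset.univ.filter Bad).card * n ^ c ≤ 2 ^ l := by nlinarith
  have hl : (0 : ℝ) < 2 ^ l := by positivity
  have hncr : (0 : ℝ) < (n : ℝ) ^ c := by positivity
  have hsum' : (2 : ℝ) ^ l ≤ (Finset.univ.filter P).card + (Finset.univ.filter Bad).card := by
    exact_mod_cast hsum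
  have hb1' : ((Finset.univ.filter Bad).card : ℝ) * 3 ≤ 2 ^ l := by exact_mod_cast hb1
  have hb2' : ((Finset.univ.filter Bad).card : ℝ) * (n : ℝ) ^ c ≤ 2 ^ l := by exact_mod_cast hb2
  have hmin : ((Finset.univ.filter Bad).card : ℝ) / 2 ^ l ≤ min (1 / 3) (1 / (n : ℝ) ^ c) := by
    refine le_min ?_ ?_
    · rw [div_le_div_iff₀ hl (by norm_num)]
      linarith
    · rw [div_le_div_iff₀ hl hncr]
      linarith
  have : 1 ≤ ((Finset.univ.filter P).card : ℝ) / 2 ^ l +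
      ((Finset.univ.filter Bad).card : ℝ) / 2 ^ l := by
    rw [← add_div, le_div_iff₀ hl]
    linarith
  linarith

/-- The random string `r` yields an evaluation point that does not separate the sets compared on
`N`. -/
def BadString (N : NetworkConfig) (r : List Bool) : Prop :=
  ¬ Set.InjOn (fingerprint (hashPrime (fieldWidth r)) (evalPoint r) N.ident)
    (comparedSets N.graph (singletonList N.ident (2 ^ fieldWidth r)) : Set (Finset N.V))

/-- The failure probability for fingerprints modulo `p` of binary length `L * (k + c + 13)`. -/
theorem error_bound {n k c L w l p s b : ℕ} (hL : 1 ≤ L) (hnL : n ≤ 2 ^ L) (hn : 0 < n)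
    (hw1 : 1 ≤ w) (hpl : p ≤ 2 ^ l) (hp : 2 ^ (w - 1) ≤ p) (hw : w = L * (k + c + 13))
    (hs : s ≤ 36 * n ^ (k + 4)) (hb : b ≤ s * (2 ^ l / p + 1)) :
    b * (3 * n ^ c) ≤ 2 ^ l := by
  have h1 : b * p ≤ s * (2 * 2 ^ l) := by
    calc b * p ≤ s * (2 ^ l / p + 1) * p := by gcongr
      _ = s * (2 ^ l / p * p + p) := by ring
      _ ≤ s * (2 ^ l + 2 ^ l) := by
        gcongr
        exact Nat.div_mul_le_self _ _
      _ = _ := by ring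
  have h2 : 2 ^ w ≤ 2 * p := by
    have : 2 ^ w = 2 * 2 ^ (w - 1) := by rw [← pow_succ', Nat.sub_add_cancel hw1]
    omega
  -- The constant `13` is `4 + 9`: the nine spare factors `2 ^ L ≥ 2` give `512`, which exceeds `3 *
  -- 144`, where `144 = 36 * 2 * 2` is the loss from the other estimates.
  have h3 : n ^ (k + 4) * n ^ c * 512 ≤ 2 ^ w := by
    have h9 : 512 ≤ (2 ^ L) ^ 9 := by
      have : 2 ^ 1 ≤ 2 ^ L := Nat.pow_le_pow_right (by norm_num) hL
      exact Nat.pow_le_pow_left this 9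
    have : 2 ^ w = (2 ^ L) ^ (k + 4) * (2 ^ L) ^ c * (2 ^ L) ^ 9 := by
      rw [hw]; ring
    rw [this]
    gcongr
  have h4 : n ^ (k + 4) * (b * (3 * n ^ c)) ≤ n ^ (k + 4) * 2 ^ l := by
    have h5 : b * (n ^ (k + 4) * n ^ c * 512) ≤ 144 * (n ^ (k + 4) * 2 ^ l) := by
      calc b * (n ^ (k + 4) * n ^ c * 512) ≤ b * (2 * p) :=
            Nat.mul_le_mul_left _ (h3.trans h2)
        _ = 2 * (b * p) := by ring
        _ ≤ 2 * (s * (2 * 2 ^ l)) := by gcongr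
        _ ≤ 2 * (36 * n ^ (k + 4) * (2 * 2 ^ l)) := by gcongr
        _ = _ := by ring
    have h6 : b * (n ^ (k + 4) * n ^ c * 512) = 512 * (n ^ (k + 4) * (b * n ^ c)) := by ring
    have h7 : n ^ (k + 4) * (b * (3 * n ^ c)) = 3 * (n ^ (k + 4) * (b * n ^ c)) := by ring
    omega
  exact Nat.le_of_mul_le_mul_left h4 (by positivity)

open Classical in
-- At most `6 n²` sets are compared, hence there are at most `36 n⁴` pairs, each with at most `n ^
-- k` colliding points, modulo a prime that is at least `2 ^ (w - 1)`.
theorem card_badString_le {N : NetworkConfig} {k c : ℕ} (hN : 0 < N.size)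
    (hk : ∀ v, N.ident v ≤ N.size ^ k) :
    (Finset.univ.filter fun r : Fin (5 * (k + c + 13) * (Nat.log 2 N.size + 1)) → Bool =>
      BadString N (List.ofFn r)).card * (3 * N.size ^ c) ≤
      2 ^ (5 * (k + c + 13) * (Nat.log 2 N.size + 1)) := by
  set n := N.size with hn
  set L := Nat.log 2 n + 1 with hL
  set l := 5 * (k + c + 13) * L with hl
  set w := (k + c + 13) * L with hw
  have hL1 : 1 ≤ L := by omega
  have hwidth : ∀ r : Fin l → Bool, fieldWidth (List.ofFn r) = w := fun r => by
    rw [fieldWidth, List.length_ofFn, hl, mul_assoc, Nat.mul_div_cancel_left _ (by norm_num)]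
  have hw2 : 2 ≤ w := by rw [hw]; nlinarith
  obtain ⟨hprime, hplow, hpup⟩ := hashPrime_spec hw2
  set p := hashPrime w with hp
  have : Fact p.Prime := ⟨hprime⟩
  let F := comparedSets N.graph (singletonList N.ident (2 ^ w))
  let S := (Finset.range p).filter fun x =>
      ¬ Set.InjOn (fingerprint p x N.ident) (F : Set (Finset N.V))
  have hF : F.card ≤ 6 * n ^ 2 := by
    have h1 := card_comparedSets_le N.graph (singletonList N.ident (2 ^ w))
    have h2 : (singletonList N.ident (2 ^ w)).length ≤ n := length_singletonList_le _ _
    calc F.card ≤ _ := h1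
      _ ≤ (n + 1) * (n * 3) := by gcongr
      _ ≤ 6 * n ^ 2 := by nlinarith
  have hS : S.card ≤ 36 * n ^ (k + 4) := by
    calc S.card ≤ F.card ^ 2 * n ^ k :=
          card_not_injOn_fingerprint_le N.ident_injective hk F
      _ ≤ (6 * n ^ 2) ^ 2 * n ^ k := by gcongr
      _ = 36 * n ^ (k + 4) := by ring
  have hbad : (Finset.univ.filter fun r : Fin l → Bool => BadString N (List.ofFn r)).card ≤
      S.card * (2 ^ l / p + 1) := by
    refine (Finset.card_le_card fun r hr => ?_).trans (card_bits_mod_le (l := l) S)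
    simp only [Finset.mem_filter, Finset.mem_univ, true_and, BadString, evalPoint, hwidth] at hr
    simp only [Finset.mem_filter, Finset.mem_univ, true_and, S, Finset.mem_range]
    exact ⟨Nat.mod_lt _ hprime.pos, hr⟩
  set b := (Finset.univ.filter fun r : Fin l → Bool => BadString N (List.ofFn r)).card with hb
  have hwl : w ≤ l := by rw [hw, hl, mul_assoc]; omega
  have hpl : p ≤ 2 ^ l := hpup.le.trans (Nat.pow_le_pow_right (by norm_num) hwl)
  exact error_bound (Nat.succ_pos _) (Nat.lt_pow_succ_log_self (by norm_num) n).le hN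
    (by omega) hpl hplow (by rw [hw, mul_comm]) hS hbad

theorem nodeAccepts_iff (N : NetworkConfig) (r : List Bool) (cert : N.V → List Bool)
    (hlen : ∀ v, (cert v).length = r.length) (v : N.V) :
    cographVerifier.NodeAccepts N r cert v ↔
      NodeCheck (fieldWidth r) (hashPrime (fieldWidth r)) (evalPoint r) (N.ident v)
        (bitsVal (cert v)) (nbrCerts N.graph (fun u => bitsVal (cert u)) v) := by
  classical
  simp [Verifier.NodeAccepts, cographVerifier, hlen, nbrCerts, Multiset.map_map]

theorem length_eq_of_nodeAccepts {N : NetworkConfig} {r : List Bool} {cert : N.V → List Bool}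
    {v : N.V} (h : cographVerifier.NodeAccepts N r cert v) : (cert v).length = r.length := by
  simp only [Verifier.NodeAccepts, cographVerifier, decide_eq_true_eq] at h
  exact h.1

theorem length_message_le (i : ℕ) (r c : List Bool) :
    (cographVerifier.message i r c).length ≤ r.length := by
  simp only [cographVerifier]
  split_ifs with h
  · exact h.le
  · simp

end Cograph

/-! ### The protocol -/

open Cograph in
/-- Cographs are recognized by two-round distributed interactive proofs with shared randomness and
`O(log n)` bits, with error probability at most `1/3` and at most `1 / n ^ c`, for any prescribed
constant `c`. -/
theorem theorem1 (c : ℕ) :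
    cographLanguage ∈
      DAMPub (fun n => min (1 / 3) (1 / (n : ℝ) ^ c)) (fun n => Nat.log 2 n + 1) := by
  intro k
  -- A certificate has five fields of `(k + c + 13) * L` bits. The random string has the same total
  -- length, and from it the nodes learn the field width without knowing `n`.
  refine ⟨cographVerifier, 5 * (k + c + 13), fun N hk => ?_⟩
  classical
  beta_reduce
  have := N.connected.nonempty
  have hn : 0 < N.size := Fintype.card_pos
  have hcard := card_badString_le (c := c) hn hk
  have hL : 1 ≤ Nat.log 2 N.size + 1 := by omega
  have hnL : N.size ≤ 2 ^ (Nat.log 2 N.size + 1) :=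
    (Nat.lt_pow_succ_log_self (by norm_num) _).le
  set L := Nat.log 2 N.size + 1
  set l := 5 * (k + c + 13) * L with hl
  set w := (k + c + 13) * L with hw
  have hlw : l = 5 * w := by rw [hl, hw, mul_assoc]
  clear_value l w L
  have hwidth : ∀ r : Fin l → Bool, fieldWidth (List.ofFn r) = w := fun r => by
    rw [fieldWidth, List.length_ofFn, hlw, Nat.mul_div_cancel_left _ (by norm_num)]
  obtain ⟨hprime, -, hpup⟩ := hashPrime_spec (w := w) (by rw [hw]; nlinarith)
  have hid : ∀ v, N.ident v < 2 ^ w := fun v => by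
    calc N.ident v ≤ N.size ^ k := hk v
      _ ≤ (2 ^ L) ^ k := Nat.pow_le_pow_left hnL k
      _ = 2 ^ (L * k) := (pow_mul _ _ _).symm
      _ < 2 ^ w := Nat.pow_lt_pow_right (by norm_num) (by rw [hw]; nlinarith)
  refine ⟨fun r cert v => ?_, fun hG => ?_, fun hG M => ?_⟩
  · exact (length_message_le (N.ident v) (List.ofFn r) cert).trans_eq List.length_ofFn
  · have hex : ∀ r : Fin l → Bool, ∃ cert : N.V → List Bool, (∀ v, (cert v).length = l) ∧
        (¬ BadString N (List.ofFn r) → ∀ v, cographVerifier.NodeAccepts N (List.ofFn r) cert v) := by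
      intro r
      obtain ⟨m, hm, hcheck⟩ := exists_nodeCheck N.connected N.ident_injective hid hprime.pos
        hpup.le hG (evalPoint (List.ofFn r))
      choose cert hlen hval using fun v => exists_bits l (m v) (hlw ▸ hm v)
      refine ⟨cert, hlen, fun hgood v => ?_⟩
      rw [nodeAccepts_iff N _ cert fun u => (hlen u).trans List.length_ofFn.symm]
      rw [BadString, not_not, hwidth] at hgood
      simpa only [hwidth, hval] using hcheck hgood v
    choose M hlen hacc using hex
    refine ⟨M, fun r v => (hlen r v).le, ?_⟩
    rw [Verifier.acceptProb]
    convert one_sub_min_le_card_div hn hcard hacc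
  · have hrej : ∀ r : Fin l → Bool, ¬ BadString N (List.ofFn r) →
        ∃ v, ¬ cographVerifier.NodeAccepts N (List.ofFn r) (M r) v := by
      intro r hgood
      by_contra hall
      push Not at hall
      refine hG (isCograph_of_nodeCheck (m := fun v => bitsVal (M r v)) N.connected
        N.ident_injective hid hprime.pos hpup.le (x := evalPoint (List.ofFn r)) ?_ fun v => ?_)
      · rwa [BadString, not_not, hwidth] at hgood
      · have := (nodeAccepts_iff N _ _ (fun u => length_eq_of_nodeAccepts (hall u)) v).1 (hall v)
        rwa [hwidth] at this
    rw [Verifier.rejectProb]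
    convert one_sub_min_le_card_div hn hcard hrej
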